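/- For $V=(v_1,\dots,v_n)\in\mathbb{R}^{d\times n}$ write $s(V)=\|V\|_F^2$, $E(V)=d\,VV^T-s(V)I_d$ and $F(V)=\mathrm{diag}(n\,V^TV-s(V)I_n)$, where $\mathrm{diag}(M)$ is the diagonal part of the matrix $M$. Call $V$ a frame if $v_1,\dots,v_n$ span $\mathbb{R}^d$. Call $V$ $\varepsilon$-doubly balanced if $\max\{\|E(V)\|_{\mathrm{op}},\|F(V)\|_{\mathrm{op}}\}\le \varepsilon\, s(V)$, and say that $V$ satisfies $(1-\lambda)$-$\infty$-expansion if $$\Big\|\sum_{j=1}^n y_j v_jv_j^T\Big\|_{\mathrm{op}}\le \frac{s(V)(1-\lambda)}{d}\qquad\text{for all } y\in\mathbb{R}^n \text{ with } \sum_j y_j=0,\ \|y\|_\infty\le 1.$$ A frame scaling solution for $V$ is a pair $(L,R)$ with $L\in\mathbb{R}^{d\times d}$ and $R\in\mathbb{R}^{n\times n}$ diagonal such that $U=LVR$ satisfies $UU^T=\frac{s(U)}{d}I_d$ and $\|u_j\|_2^2=\frac{s(U)}{n}$ for every column $u_j$ of $U$. The dynamical system started at $V$ is a solution $(V_t,L_t,R_t)_{t\ge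 0}$ of $$-\partial_tV_t=E(V_t)V_t+V_tF(V_t),\quad -\partial_tL_t=E(V_t)L_t,\quad -\partial_tR_t=R_tF(V_t),\qquad V_0=V,\ L_0=I_d,\ R_0=I_n.$$ **Theorem.** There are universal constants $c,C_1,C_2>0$ such that the following holds for all $d,n$, all frames $V\in\mathbb{R}^{d\times n}$, and all $\varepsilon\ge 0$, $\lambda>0$ with $\lambda^2\ge c\,\varepsilon$. If $V$ is $\varepsilon$-doubly balanced and satisfies $(1-\lambda)$-$\infty$-expansion, then the dynamical system started at $V$ has a solution for all times $t\ge 0$, and for every such solution $R_t$ is diagonal and $V_t=L_tVR_t$ for all $t\ge0$. Moreover: 1. the limit $(L_\infty,R_\infty)=\lim_{t\to\infty}(L_t,R_t)$ exists and is a frame scaling solution for $V$; 2. $\|L_\infty-I_d\|_{\mathrm{op}}\le C_1\,\varepsilon/\lambda$ and $\|R_\infty-I_n\|_{\mathrm{op}}\le C_1\,\varepsilon/\lambda$; 3. $V_\infty=\lim_{t\to\infty}V_t=L_\infty VR_\infty$ satisfies $(1-\lambda/2)$-$\infty$-expansion, and $s(V_\infty)\ge s(V)\,(1-C_2\,\varepsilon^2/\lambda)$.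 -/

import Mathlib

open Filter Topology
-- On real matrices, `‖·‖` is the operator norm with respect to the Euclidean norms.
open scoped Matrix Matrix.Norms.L2Operator

namespace FrameScaling

variable {d n : ℕ}

/-- The columns of `V` span `ℝ^d`. -/
def IsFrame (V : Matrix (Fin d) (Fin n) ℝ) : Prop :=
  Submodule.span ℝ (Set.range V.col) = ⊤

/-- The size `s(V) = ‖V‖_F²`. -/
def size (V : Matrix (Fin d) (Fin n) ℝ) : ℝ :=
  ∑ i, ∑ j, V i j ^ 2

/-- The isotropy error `E(V) = d V Vᵀ - s(V) I_d`. -/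
def errE (V : Matrix (Fin d) (Fin n) ℝ) : Matrix (Fin d) (Fin d) ℝ :=
  (d : ℝ) • (V * Vᵀ) - size V • (1 : Matrix (Fin d) (Fin d) ℝ)

/-- The equal-norm error `F(V) = diag(n Vᵀ V - s(V) I_n)`. -/
def errF (V : Matrix (Fin d) (Fin n) ℝ) : Matrix (Fin n) (Fin n) ℝ :=
  Matrix.diagonal
    (Matrix.diag ((n : ℝ) • (Vᵀ * V) - size V • (1 : Matrix (Fin n) (Fin n) ℝ)))

/-- `V` is `ε`-doubly balanced. -/
def DoublyBalanced (V : Matrix (Fin d) (Fin n) ℝ) (ε : ℝ) : Prop :=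
  max ‖errE V‖ ‖errF V‖ ≤ size V * ε

/-- `V` satisfies `α`-`∞`-expansion; it is used with `α = 1 - λ`. -/
def InftyExpansion (V : Matrix (Fin d) (Fin n) ℝ) (α : ℝ) : Prop :=
  ∀ y : Fin n → ℝ, ∑ j, y j = 0 → (∀ j, |y j| ≤ 1) →
    ‖∑ j, y j • Matrix.vecMulVec (V.col j) (V.col j)‖ ≤ size V * α / d

/-- `(L, R)` is a frame scaling solution for `V`: `R` is diagonal, and `U = L V R` satisfies
`U Uᵀ = (s(U)/d) I_d` and `‖u_j‖² = s(U)/n` for all `j`. -/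
def IsScalingSolution (V : Matrix (Fin d) (Fin n) ℝ)
    (L : Matrix (Fin d) (Fin d) ℝ) (R : Matrix (Fin n) (Fin n) ℝ) : Prop :=
  R.IsDiag ∧
  (L * V * R) * (L * V * R)ᵀ = (size (L * V * R) / d) • (1 : Matrix (Fin d) (Fin d) ℝ) ∧
  ∀ j, ∑ i, (L * V * R) i j ^ 2 = size (L * V * R) / n

/-- `(V_t, L_t, R_t)`, `t ≥ 0`, is the dynamical system started at `V`:
`-∂ₜ V_t = E(V_t) V_t + V_t F(V_t)`, with the scalings it generates,
`-∂ₜ L_t = E(V_t) L_t` and `-∂ₜ R_t = R_t F(V_t)` (the product integrals of `-E(V_t)` and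
`-F(V_t)`). Values at negative times are irrelevant; derivatives at `0` are one-sided. -/
structure IsFlow (V : Matrix (Fin d) (Fin n) ℝ) (Vt : ℝ → Matrix (Fin d) (Fin n) ℝ)
    (Lt : ℝ → Matrix (Fin d) (Fin d) ℝ) (Rt : ℝ → Matrix (Fin n) (Fin n) ℝ) : Prop where
  init_V : Vt 0 = V
  init_L : Lt 0 = 1
  init_R : Rt 0 = 1
  deriv_V : ∀ t, 0 ≤ t →
    HasDerivWithinAt Vt (-(errE (Vt t) * Vt t + Vt t * errF (Vt t))) (Set.Ici 0) t
  deriv_L : ∀ t, 0 ≤ t → HasDerivWithinAt Lt (-(errE (Vt t) * Lt t)) (Set.Ici 0) t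
  deriv_R : ∀ t, 0 ≤ t → HasDerivWithinAt Rt (-(Rt t * errF (Vt t))) (Set.Ici 0) t

end FrameScaling

/-! Along the flow the errors E, F obey linear damping at rate 2s, with s the current size, plus a
forcing. Up to quadratic terms the forcing is a coupling: E is driven by -2d V F Vᵀ, and F_j by -2n
v_jᵀ E v_j. Since F is trace-free, ∞-expansion bounds the first by 2s(1-λ)‖F‖
(`norm_smul_mul_errF_mul_transpose_le`); the second is only bounded by about 2s‖E‖. The gain in one
direction suffices: in max((1+λ/4)‖E‖, ‖F‖) both couplings fall below damping by a fraction of order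
λ, so the errors decay like exp(-s(V)λt/12) (`force_lt_of_bounds`, `IsFlow.errors_le`).

Expansion is needed at every time, not only at the start. It survives scalings within O(λ) of the
identity (`InftyExpansion.scaling`). Integrating the decay keeps L_t and R_t within O(ε/λ) of the
identity, which is far below λ when λ² ≥ cε. A continuity argument closes this loop in
`IsFlow.bounds_of_pos`.

Existence for all time holds because the size is nonincreasing along the flow and has bounded
sublevel sets. Convergence follows from integrable derivatives, and every asserted property is
closed under limits. -/

namespace FrameScaling

/-! ### Ordinary differential equations -/

section ODE

variable {E : Type*} [NormedAddCommGroup E] [NormedSpace ℝ E]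

/-- A bounded, globally Lipschitz vector field has a global integral curve through every point. -/
theorem exists_integralCurve_of_lipschitzWith_of_bounded [CompleteSpace E] {v : E → E}
    {K M : NNReal} (hv : LipschitzWith K v) (hM : ∀ x, ‖v x‖ ≤ M) (x₀ : E) :
    ∃ α : ℝ → E, α 0 = x₀ ∧ ∀ t, HasDerivAt α (v (α t)) t := by
  have hloc : ∀ N : ℕ, ∃ α : ℝ → E, α 0 = x₀ ∧
      ∀ t ∈ Set.Ioo (-(N + 1 : ℝ)) (N + 1), HasDerivAt α (v (α t)) t := by
    intro N
    have h0 : (0 : ℝ) ∈ Set.Icc (-(N + 1 : ℝ)) (N + 1) := by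
      constructor <;> linarith [N.cast_nonneg (α := ℝ)]
    -- A ball of radius `M * (N + 1)` cannot be left during this time at speed at most `M`, so the
    -- interval need not be shrunk.
    have hPL : IsPicardLindelof (fun _ ↦ v) (⟨0, h0⟩ : Set.Icc (-(N + 1 : ℝ)) (N + 1)) x₀
        (M * (N + 1)) 0 M K := by
      refine IsPicardLindelof.of_time_independent (fun x _ ↦ hM x) hv.lipschitzOnWith ?_
      simp
    obtain ⟨α, h₁, h₂⟩ := hPL.exists_eq_forall_mem_Icc_hasDerivWithinAt₀
    exact ⟨α, h₁, fun t ht ↦ (h₂ t (Set.Ioo_subset_Icc_self ht)).hasDerivAt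
      (Icc_mem_nhds ht.1 ht.2)⟩
  choose α h0 hα using hloc
  have heq : ∀ N M : ℕ, N ≤ M → Set.EqOn (α N) (α M) (Set.Ioo (-(N + 1 : ℝ)) (N + 1)) := by
    intro N M hNM
    have hNM' : (N : ℝ) ≤ M := by exact_mod_cast hNM
    refine ODE_solution_unique_of_mem_Ioo (v := fun _ ↦ v) (s := fun _ ↦ Set.univ) (K := K)
      (t₀ := 0) (fun _ _ ↦ hv.lipschitzOnWith) ?_ (fun t ht ↦ ⟨hα N t ht, trivial⟩)
      (fun t ht ↦ ⟨hα M t ⟨by linarith [ht.1], by linarith [ht.2]⟩, trivial⟩) (by rw [h0, h0])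
    constructor <;> linarith [N.cast_nonneg (α := ℝ)]
  have key : ∀ N : ℕ, Set.EqOn (fun t ↦ α ⌈|t|⌉₊ t) (α N) (Set.Ioo (-(N + 1 : ℝ)) (N + 1)) := by
    intro N t ht
    rcases le_total ⌈|t|⌉₊ N with h | h
    · have := abs_le.1 (Nat.le_ceil |t|)
      exact heq _ _ h ⟨by linarith, by linarith⟩
    · exact (heq _ _ h ht).symm
  refine ⟨fun t ↦ α ⌈|t|⌉₊ t, by simpa using h0 0, fun t ↦ ?_⟩
  have ht : t ∈ Set.Ioo (-((⌈|t|⌉₊ : ℕ) + 1 : ℝ)) ((⌈|t|⌉₊ : ℕ) + 1) := by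
    have := abs_le.1 (Nat.le_ceil |t|)
    exact ⟨by linarith, by linarith⟩
  exact (hα _ t ht).congr_of_eventuallyEq
    ((key ⌈|t|⌉₊).eventuallyEq_of_mem (Ioo_mem_nhds ht.1 ht.2))

/-- A `C¹` vector field that does not increase a function with bounded sublevel sets has integral
curves for all positive times. -/
theorem exists_integralCurve_of_antitone [FiniteDimensional ℝ E] {v : E → E}
    (hv : ContDiff ℝ 1 v) {g : E → ℝ} {g' : E → E →L[ℝ] ℝ}
    (hg : ∀ x, HasFDerivAt g (g' x) x) (hdec : ∀ x, g' x (v x) ≤ 0) (x₀ : E)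
    (hbdd : Bornology.IsBounded {x | g x ≤ g x₀}) :
    ∃ α : ℝ → E, α 0 = x₀ ∧ ∀ t, 0 ≤ t → HasDerivAt α (v (α t)) t := by
  have : CompleteSpace E := FiniteDimensional.complete ℝ E
  obtain ⟨r, hr0, hr⟩ := hbdd.subset_closedBall_lt 0 0
  -- The cutoff makes the field bounded and Lipschitz. Being nonnegative, it preserves the descent
  -- of `g`, so the curve never leaves the ball where `χ = 1`.
  let χ : ContDiffBump (0 : E) := ⟨r, r + 1, hr0, by linarith⟩
  have hw : ContDiff ℝ 1 fun x ↦ χ x • v x := χ.contDiff.smul hv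
  have hsupp : HasCompactSupport fun x ↦ χ x • v x := χ.hasCompactSupport.smul_right
  obtain ⟨K, hK⟩ := hw.lipschitzWith_of_hasCompactSupport hsupp one_ne_zero
  obtain ⟨M, hM⟩ := hsupp.exists_bound_of_continuous hw.continuous
  obtain ⟨α, h0, hα⟩ := exists_integralCurve_of_lipschitzWith_of_bounded (M := M.toNNReal) hK
    (fun x ↦ (hM x).trans (Real.le_coe_toNNReal M)) x₀
  have hgα : Antitone (g ∘ α) := by
    refine antitone_of_hasDerivAt_nonpos (f' := fun t ↦ g' (α t) (χ (α t) • v (α t)))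
      (fun t ↦ (hg (α t)).comp_hasDerivAt t (hα t)) fun t ↦ ?_
    change g' (α t) (χ (α t) • v (α t)) ≤ 0
    rw [map_smul, smul_eq_mul]
    exact mul_nonpos_of_nonneg_of_nonpos χ.nonneg (hdec _)
  refine ⟨α, h0, fun t ht ↦ ?_⟩
  have hmem : α t ∈ Metric.closedBall (0 : E) r := hr (by simpa [h0] using hgα ht)
  have := hα t
  rwa [χ.one_of_mem_closedBall hmem, one_smul] at this

/-- Fencing for `Φ' = -σ Φ + G`: the norm of `Φ` stays below `B` as long as
`‖G‖ < σ B + B'` at the times where `‖Φ‖ = B`. -/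
theorem norm_le_of_hasDerivWithinAt_damped {Φ G : ℝ → E} {σ B B' : ℝ → ℝ} {T : ℝ}
    (hσ : ContinuousOn σ (Set.Ici 0))
    (hΦ : ∀ t, 0 ≤ t → HasDerivWithinAt Φ (-(σ t • Φ t) + G t) (Set.Ici 0) t)
    (hB : ∀ t, HasDerivAt B (B' t) t) (h0 : ‖Φ 0‖ ≤ B 0)
    (hbound : ∀ t ∈ Set.Ico 0 T, ‖Φ t‖ = B t → ‖G t‖ < σ t * B t + B' t) :
    ∀ t ∈ Set.Icc 0 T, ‖Φ t‖ ≤ B t := by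
  -- The integrating factor must be differentiable on all of `ℝ`, so `σ` is extended by a constant
  -- to negative times.
  let σ' : ℝ → ℝ := fun t ↦ σ (max t 0)
  have hσ' : Continuous σ' :=
    hσ.comp_continuous (continuous_id.max continuous_const) fun t ↦ le_max_right t 0
  let S : ℝ → ℝ := fun t ↦ ∫ u in (0 : ℝ)..t, σ' u
  have hS : ∀ t, HasDerivAt S (σ' t) t := fun t ↦
    intervalIntegral.integral_hasDerivAt_right (hσ'.intervalIntegrable _ _)
      (hσ'.stronglyMeasurableAtFilter _ _) hσ'.continuousAt
  have hσeq : ∀ t, 0 ≤ t → σ' t = σ t := fun t ht ↦ by simp [σ', max_eq_left ht]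
  have hexp : ∀ t, HasDerivAt (fun t ↦ Real.exp (S t)) (Real.exp (S t) * σ' t) t := fun t ↦
    (hS t).exp
  have hΨ : ∀ t, 0 ≤ t → HasDerivWithinAt (fun t ↦ Real.exp (S t) • Φ t)
      (Real.exp (S t) • G t) (Set.Ici 0) t := fun t ht ↦ by
    refine ((hexp t).hasDerivWithinAt.fun_smul (hΦ t ht)).congr_deriv ?_
    rw [hσeq t ht]
    module
  have hfence := image_norm_le_of_norm_deriv_right_lt_deriv_boundary
    (f := fun t ↦ Real.exp (S t) • Φ t) (f' := fun t ↦ Real.exp (S t) • G t) (a := 0) (b := T)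
    (B := fun t ↦ Real.exp (S t) * B t)
    (B' := fun t ↦ Real.exp (S t) * σ' t * B t + Real.exp (S t) * B' t)
    (fun t ht ↦ ((hΨ t ht.1).continuousWithinAt).mono Set.Icc_subset_Ici_self)
    (fun t ht ↦ (hΨ t ht.1).mono (Set.Ici_subset_Ici.2 ht.1))
    (by simpa [norm_smul, S] using h0)
    (fun t ↦ (hexp t).mul (hB t))
    (fun t ht hEq ↦ by
      have hpos := Real.exp_pos (S t)
      rw [norm_smul, Real.norm_eq_abs, abs_of_pos hpos] at hEq ⊢
      have := hbound t ht (mul_left_cancel₀ hpos.ne' hEq)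
      rw [hσeq t ht.1]
      calc Real.exp (S t) * ‖G t‖ < Real.exp (S t) * (σ t * B t + B' t) := by gcongr
        _ = _ := by ring)
  intro t ht
  have hpos := Real.exp_pos (S t)
  have := hfence ht
  rw [norm_smul, Real.norm_eq_abs, abs_of_pos hpos] at this
  exact le_of_mul_le_mul_left this hpos

/-- A function whose derivative decays exponentially. -/
theorem norm_sub_le_of_norm_deriv_le_exp {f f' : ℝ → E} {K μ T : ℝ} (hμ : 0 < μ)
    (hf : ∀ t, 0 ≤ t → HasDerivWithinAt f (f' t) (Set.Ici 0) t)
    (hbound : ∀ t ∈ Set.Ico 0 T, ‖f' t‖ ≤ K * Real.exp (-μ * t)) {u t : ℝ} (hu : 0 ≤ u)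
    (hut : u ≤ t) (htT : t ≤ T) :
    ‖f t - f u‖ ≤ K / μ * (Real.exp (-μ * u) - Real.exp (-μ * t)) := by
  have hexp : ∀ t, HasDerivAt (fun t ↦ K / μ * (Real.exp (-μ * u) - Real.exp (-μ * t)))
      (K * Real.exp (-μ * t)) t := fun t ↦ by
    have h1 : HasDerivAt (fun t : ℝ ↦ -μ * t) (-μ) t := by
      simpa using (hasDerivAt_id t).const_mul (-μ)
    refine ((h1.exp.const_sub (Real.exp (-μ * u))).const_mul (K / μ)).congr_deriv ?_
    field_simp
  exact image_norm_le_of_norm_deriv_right_le_deriv_boundary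
    (f := fun t ↦ f t - f u) (f' := f') (a := u) (b := T)
    (fun t ht ↦ (((hf t (hu.trans ht.1)).sub_const (f u)).continuousWithinAt).mono
      fun x hx ↦ hu.trans hx.1)
    (fun t ht ↦ ((hf t (hu.trans ht.1)).sub_const (f u)).mono
      (Set.Ici_subset_Ici.2 (hu.trans ht.1)))
    (by simp) hexp (fun t ht ↦ hbound t ⟨hu.trans ht.1, ht.2⟩) ⟨hut, htT⟩

theorem norm_sub_le_of_norm_deriv_le_exp_zero {f f' : ℝ → E} {K μ T : ℝ} (hμ : 0 < μ) (hK : 0 ≤ K)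
    (hf : ∀ t, 0 ≤ t → HasDerivWithinAt f (f' t) (Set.Ici 0) t)
    (hbound : ∀ t ∈ Set.Ico 0 T, ‖f' t‖ ≤ K * Real.exp (-μ * t)) (hT : 0 ≤ T) :
    ‖f T - f 0‖ ≤ K / μ := by
  refine (norm_sub_le_of_norm_deriv_le_exp hμ hf hbound le_rfl hT le_rfl).trans ?_
  have h1 := Real.exp_pos (-μ * T)
  have h2 : 0 ≤ K / μ := by positivity
  rw [mul_zero, Real.exp_zero]
  nlinarith

theorem exists_tendsto_of_norm_deriv_le_exp [CompleteSpace E] {f f' : ℝ → E} {K μ : ℝ}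
    (hμ : 0 < μ) (hK : 0 ≤ K) (hf : ∀ t, 0 ≤ t → HasDerivWithinAt f (f' t) (Set.Ici 0) t)
    (hbound : ∀ t, 0 ≤ t → ‖f' t‖ ≤ K * Real.exp (-μ * t)) :
    ∃ x, Tendsto f atTop (𝓝 x) := by
  refine cauchy_map_iff_exists_tendsto.1 ?_
  have hdecay : Tendsto (fun t ↦ K / μ * Real.exp (-μ * t)) atTop (𝓝 0) := by
    have : Tendsto (fun t : ℝ ↦ -μ * t) atTop atBot :=
      tendsto_id.const_mul_atTop_of_neg (by linarith)
    simpa using (Real.tendsto_exp_atBot.comp this).const_mul (K / μ)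
  have hle : ∀ u t, 0 ≤ u → u ≤ t → dist (f u) (f t) ≤ K / μ * Real.exp (-μ * u) := by
    intro u t hu hut
    rw [dist_comm, dist_eq_norm]
    refine (norm_sub_le_of_norm_deriv_le_exp hμ hf (fun t ht ↦ hbound t ht.1) hu hut le_rfl).trans ?_
    have h1 := Real.exp_pos (-μ * t)
    have h2 : 0 ≤ K / μ := by positivity
    nlinarith
  refine Metric.cauchy_iff.2 ⟨inferInstance, fun ε hε ↦ ?_⟩
  obtain ⟨u, hu⟩ := ((hdecay.eventually (gt_mem_nhds (half_pos hε))).and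
    (eventually_ge_atTop 0)).exists
  refine ⟨f '' Set.Ici u, image_mem_map (Ici_mem_atTop u), ?_⟩
  rintro _ ⟨a, ha, rfl⟩ _ ⟨b, hb, rfl⟩
  have h1 := hle u a hu.2 ha
  have h2 := hle u b hu.2 hb
  have h3 := dist_triangle_left (f a) (f b) (f u)
  linarith [hu.1]

/-- A continuous function on `[0, ∞)` that is positive at `0` and cannot vanish for the first time
is positive. -/
theorem pos_of_forall_Ico_pos {g : ℝ → ℝ} (hg : ContinuousOn g (Set.Ici 0))
    (h : ∀ t, 0 ≤ t → (∀ u ∈ Set.Ico 0 t, 0 < g u) → 0 < g t) : ∀ t, 0 ≤ t → 0 < g t := by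
  by_contra! hcon
  obtain ⟨t, ht0, ht⟩ := hcon
  -- The infimum of this closed set would be the first time at which `g` is not positive.
  let A : Set ℝ := Set.Ici 0 ∩ g ⁻¹' Set.Iic 0
  have hA : IsClosed A := hg.preimage_isClosed_of_isClosed isClosed_Ici isClosed_Iic
  have hbdd : BddBelow A := ⟨0, fun x hx ↦ hx.1⟩
  have hmem : sInf A ∈ A := hA.csInf_mem ⟨t, ht0, ht⟩ hbdd
  refine (h (sInf A) hmem.1 fun u hu ↦ ?_).not_ge hmem.2
  by_contra! hcon
  exact (csInf_le hbdd ⟨hu.1, hcon⟩).not_gt hu.2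

/-- Uniqueness for linear homogeneous equations on `[0, ∞)`. -/
theorem eq_zero_of_norm_deriv_le_mul {f f' : ℝ → E} {k : ℝ → ℝ}
    (hk : ContinuousOn k (Set.Ici 0))
    (hf : ∀ t, 0 ≤ t → HasDerivWithinAt f (f' t) (Set.Ici 0) t) (h0 : f 0 = 0)
    (hbound : ∀ t, 0 ≤ t → ‖f' t‖ ≤ k t * ‖f t‖) : ∀ t, 0 ≤ t → f t = 0 := by
  intro T hT
  have hsub : Set.Icc 0 T ⊆ Set.Ici 0 := Set.Icc_subset_Ici_self
  obtain ⟨K, hK⟩ := isCompact_Icc.bddAbove_image (hk.mono hsub)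
  refine eq_zero_of_abs_deriv_le_mul_abs_self_of_eq_zero_right (K := K) (b := T)
    (fun t ht ↦ (hf t ht.1).continuousWithinAt.mono Set.Icc_subset_Ici_self)
    (fun t ht ↦ (hf t ht.1).mono (Set.Ici_subset_Ici.2 ht.1)) h0 (fun t ht ↦ ?_) T ⟨hT, le_rfl⟩
  exact (hbound t ht.1).trans (mul_le_mul_of_nonneg_right
    (hK ⟨t, Set.Ico_subset_Icc_self ht, rfl⟩) (norm_nonneg _))

end ODE

/-! ### Calculus of matrix-valued curves -/

section MatrixCalculus

variable {l m k : Type*} [Fintype m] [Fintype k]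

theorem hasDerivWithinAt_matrix_iff {A : ℝ → Matrix l m ℝ} {A' : Matrix l m ℝ} {s : Set ℝ} {t : ℝ} :
    HasDerivWithinAt A A' s t ↔
      ∀ i j, HasDerivWithinAt (fun u ↦ A u i j) (A' i j) s t :=
  (hasDerivWithinAt_pi (φ := fun u i ↦ A u i) (φ' := fun i ↦ A' i)).trans
    (forall_congr' fun _ ↦ hasDerivWithinAt_pi)

theorem HasDerivWithinAt.matrix_mul {A : ℝ → Matrix l m ℝ} {A' : Matrix l m ℝ}
    {B : ℝ → Matrix m k ℝ} {B' : Matrix m k ℝ} {s : Set ℝ} {t : ℝ}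
    (hA : HasDerivWithinAt A A' s t) (hB : HasDerivWithinAt B B' s t) :
    HasDerivWithinAt (fun u ↦ A u * B u) (A' * B t + A t * B') s t := by
  rw [hasDerivWithinAt_matrix_iff] at *
  intro i j
  simp only [Matrix.mul_apply, Matrix.add_apply, ← Finset.sum_add_distrib]
  exact HasDerivWithinAt.fun_sum fun x _ ↦ (hA i x).mul (hB x j)

variable [Fintype l]

theorem HasDerivWithinAt.matrix_transpose {A : ℝ → Matrix l m ℝ} {A' : Matrix l m ℝ} {s : Set ℝ}
    {t : ℝ} (hA : HasDerivWithinAt A A' s t) :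
    HasDerivWithinAt (fun u ↦ (A u)ᵀ) A'ᵀ s t := by
  rw [hasDerivWithinAt_matrix_iff] at *
  exact fun i j ↦ hA j i

theorem HasDerivWithinAt.matrix_trace {A : ℝ → Matrix l l ℝ} {A' : Matrix l l ℝ} {s : Set ℝ}
    {t : ℝ} (hA : HasDerivWithinAt A A' s t) :
    HasDerivWithinAt (fun u ↦ (A u).trace) A'.trace s t := by
  rw [hasDerivWithinAt_matrix_iff] at hA
  exact HasDerivWithinAt.fun_sum fun i _ ↦ hA i i

theorem HasDerivWithinAt.matrix_diagonal [DecidableEq l] {a : ℝ → l → ℝ} {a' : l → ℝ} {s : Set ℝ}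
    {t : ℝ} (ha : ∀ i, HasDerivWithinAt (fun u ↦ a u i) (a' i) s t) :
    HasDerivWithinAt (fun u ↦ Matrix.diagonal (a u)) (Matrix.diagonal a') s t := by
  rw [hasDerivWithinAt_matrix_iff]
  intro i j
  rcases eq_or_ne i j with rfl | h
  · simpa using ha i
  · simpa [h] using hasDerivWithinAt_const _ _ _

/-! ### Operator norm inequalities. -/

theorem abs_dotProduct_mulVec_le [DecidableEq l] (A : Matrix l l ℝ) (x : l → ℝ) :
    |x ⬝ᵥ A *ᵥ x| ≤ ‖A‖ * ∑ i, x i ^ 2 := by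
  have h1 : x ⬝ᵥ A *ᵥ x = inner ℝ (WithLp.toLp 2 x) (WithLp.toLp 2 (A *ᵥ x)) := by
    simp [PiLp.inner_apply, dotProduct, mul_comm]
  have h2 := Matrix.l2_opNorm_mulVec A (WithLp.toLp 2 x)
  have h3 : ∑ i, x i ^ 2 = ‖WithLp.toLp 2 x‖ * ‖WithLp.toLp 2 x‖ := by
    rw [← sq, EuclideanSpace.norm_sq_eq]; simp
  rw [h1, h3]
  refine (abs_real_inner_le_norm _ _).trans ?_
  calc _ ≤ ‖WithLp.toLp 2 x‖ * (‖A‖ * ‖WithLp.toLp 2 x‖) := by gcongr; exact h2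
    _ = _ := by ring

theorem abs_diag_le_l2_opNorm [DecidableEq l] (A : Matrix l l ℝ) (i : l) : |A i i| ≤ ‖A‖ := by
  have := abs_dotProduct_mulVec_le A (Pi.single i 1)
  simpa [Pi.single_apply, ite_pow] using this

theorem abs_trace_le_card_mul_l2_opNorm [DecidableEq l] (A : Matrix l l ℝ) :
    |A.trace| ≤ Fintype.card l * ‖A‖ := by
  refine (Finset.abs_sum_le_sum_abs _ _).trans ?_
  refine (Finset.sum_le_sum fun i _ ↦ abs_diag_le_l2_opNorm A i).trans ?_
  simp

theorem l2_opNorm_transpose [DecidableEq l] [DecidableEq m] (A : Matrix l m ℝ) : ‖Aᵀ‖ = ‖A‖ := by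
  rw [← Matrix.conjTranspose_eq_transpose_of_trivial, Matrix.l2_opNorm_conjTranspose]

theorem l2_opNorm_mul_transpose_self [DecidableEq l] [DecidableEq m] (A : Matrix l m ℝ) :
    ‖A * Aᵀ‖ = ‖A‖ * ‖A‖ := by
  have := Matrix.l2_opNorm_conjTranspose_mul_self Aᵀ
  rwa [Matrix.conjTranspose_eq_transpose_of_trivial, Matrix.transpose_transpose,
    l2_opNorm_transpose] at this

theorem l2_opNorm_one_le [DecidableEq l] : ‖(1 : Matrix l l ℝ)‖ ≤ 1 := by
  rw [← Matrix.diagonal_one, Matrix.l2_opNorm_diagonal, pi_norm_le_iff_of_nonneg zero_le_one]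
  simp

end MatrixCalculus

/-! ### The error matrices -/

variable {d n : ℕ}

/-- The vector field of the dynamical system. -/
def field (V : Matrix (Fin d) (Fin n) ℝ) : Matrix (Fin d) (Fin n) ℝ :=
  -(errE V * V + V * errF V)

/-- The diagonal entries of `errF V`. -/
def colErr (V : Matrix (Fin d) (Fin n) ℝ) (j : Fin n) : ℝ :=
  n * ∑ i, V i j ^ 2 - size V

/-- Half of the rate at which the size decreases. -/
noncomputable def dissipation (V : Matrix (Fin d) (Fin n) ℝ) : ℝ :=
  (errE V * errE V).trace / d + (∑ j, colErr V j ^ 2) / n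

theorem transpose_mul_self_diag (V : Matrix (Fin d) (Fin n) ℝ) (j : Fin n) :
    (Vᵀ * V) j j = ∑ i, V i j ^ 2 := by
  simp [Matrix.mul_apply, sq]

theorem size_eq_trace (V : Matrix (Fin d) (Fin n) ℝ) : size V = (V * Vᵀ).trace := by
  simp [size, Matrix.trace, Matrix.mul_apply, sq]

theorem errF_eq (V : Matrix (Fin d) (Fin n) ℝ) : errF V = Matrix.diagonal (colErr V) := by
  unfold errF colErr
  congr 1
  ext j
  simp [transpose_mul_self_diag]

theorem errE_isSymm (V : Matrix (Fin d) (Fin n) ℝ) : (errE V)ᵀ = errE V := by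
  simp [errE]

theorem smul_mul_transpose (V : Matrix (Fin d) (Fin n) ℝ) :
    (d : ℝ) • (V * Vᵀ) = errE V + size V • (1 : Matrix (Fin d) (Fin d) ℝ) := by
  simp [errE]

theorem size_nonneg (V : Matrix (Fin d) (Fin n) ℝ) : 0 ≤ size V := by
  unfold size; positivity

theorem trace_errE (V : Matrix (Fin d) (Fin n) ℝ) : (errE V).trace = 0 := by
  simp [errE, ← size_eq_trace, mul_comm]

theorem sum_colErr (V : Matrix (Fin d) (Fin n) ℝ) : ∑ j, colErr V j = 0 := by
  simp only [colErr, Finset.sum_sub_distrib, ← Finset.mul_sum]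
  rw [Finset.sum_comm]
  simp [size]

theorem abs_colErr_le (V : Matrix (Fin d) (Fin n) ℝ) (j : Fin n) : |colErr V j| ≤ ‖errF V‖ := by
  rw [errF_eq, Matrix.l2_opNorm_diagonal]
  exact norm_le_pi_norm (colErr V) j

@[fun_prop]
theorem continuous_size : Continuous (size : Matrix (Fin d) (Fin n) ℝ → ℝ) := by
  unfold size; fun_prop

@[fun_prop]
theorem continuous_errE : Continuous (errE : Matrix (Fin d) (Fin n) ℝ → _) := by
  unfold errE; fun_prop

@[fun_prop]
theorem continuous_errF : Continuous (errF : Matrix (Fin d) (Fin n) ℝ → _) := by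
  unfold errF; fun_prop

theorem dissipation_nonneg (V : Matrix (Fin d) (Fin n) ℝ) : 0 ≤ dissipation V := by
  have : 0 ≤ (errE V * errE V).trace := by
    nth_rw 1 [← errE_isSymm V]
    simp only [Matrix.trace, Matrix.diag, transpose_mul_self_diag]
    positivity
  unfold dissipation
  positivity

theorem dissipation_le (V : Matrix (Fin d) (Fin n) ℝ) :
    dissipation V ≤ ‖errE V‖ ^ 2 + ‖errF V‖ ^ 2 := by
  unfold dissipation
  gcongr
  · refine div_le_of_le_mul₀ (by positivity) (by positivity) ?_
    refine (le_abs_self _).trans ((abs_trace_le_card_mul_l2_opNorm _).trans ?_)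
    rw [Fintype.card_fin, mul_comm, sq]
    gcongr
    exact Matrix.l2_opNorm_mul _ _
  · refine div_le_of_le_mul₀ (by positivity) (by positivity) ?_
    calc ∑ j, colErr V j ^ 2 ≤ ∑ _j : Fin n, ‖errF V‖ ^ 2 := by
          refine Finset.sum_le_sum fun j _ ↦ ?_
          rw [← sq_abs]
          gcongr
          exact abs_colErr_le V j
      _ = _ := by simp [mul_comm]

/-! ### Evolution of the size and of the errors. -/

theorem trace_field_mul_transpose (V : Matrix (Fin d) (Fin n) ℝ) :
    (field V * Vᵀ).trace = -dissipation V := by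
  -- In `d V Vᵀ = errE V + size V • 1` the scalar part pairs to zero with the trace-free `errE V`.
  have h1 : (errE V * V * Vᵀ).trace = (errE V * errE V).trace / d := by
    rcases eq_or_ne d 0 with rfl | hd
    · simp [Matrix.trace]
    have hd' : (d : ℝ) ≠ 0 := by exact_mod_cast hd
    rw [eq_div_iff hd', mul_comm, ← smul_eq_mul, ← Matrix.trace_smul, Matrix.mul_assoc,
      ← Matrix.mul_smul, smul_mul_transpose, Matrix.mul_add, Matrix.trace_add]
    simp [trace_errE]
  have h2 : (V * errF V * Vᵀ).trace = (∑ j, colErr V j ^ 2) / n := by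
    rcases eq_or_ne n 0 with rfl | hn
    · simp [Matrix.trace]
    have hn' : (n : ℝ) ≠ 0 := by exact_mod_cast hn
    rw [eq_div_iff hn', Matrix.trace_mul_comm, ← Matrix.mul_assoc, errF_eq]
    simp only [Matrix.trace, Matrix.diag, Matrix.mul_diagonal, transpose_mul_self_diag]
    have h3 : ∀ j, (∑ i, V i j ^ 2) * colErr V j * n =
        colErr V j ^ 2 + size V * colErr V j := fun j ↦ by
      unfold colErr; ring
    rw [Finset.sum_mul, Finset.sum_congr rfl fun j _ ↦ h3 j, Finset.sum_add_distrib,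
      ← Finset.mul_sum, sum_colErr, mul_zero, add_zero]
  rw [field, Matrix.neg_mul, Matrix.add_mul, Matrix.trace_neg, Matrix.trace_add, h1, h2,
    dissipation]

theorem hasDerivWithinAt_size {Vt : ℝ → Matrix (Fin d) (Fin n) ℝ} {s : Set ℝ} {t : ℝ}
    (h : HasDerivWithinAt Vt (field (Vt t)) s t) :
    HasDerivWithinAt (fun u ↦ size (Vt u)) (-(2 * dissipation (Vt t))) s t := by
  simp only [size_eq_trace]
  refine (HasDerivWithinAt.matrix_trace
    (HasDerivWithinAt.matrix_mul h (HasDerivWithinAt.matrix_transpose h))).congr_deriv ?_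
  rw [Matrix.trace_add, ← Matrix.trace_transpose (Vt t * _), Matrix.transpose_mul,
    Matrix.transpose_transpose, trace_field_mul_transpose]
  ring

/-- The part of the derivative of `errE` that is not damping. -/
noncomputable def forceE (V : Matrix (Fin d) (Fin n) ℝ) : Matrix (Fin d) (Fin d) ℝ :=
  -((2 : ℝ) • (errE V * errE V)) - (2 * d : ℝ) • (V * errF V * Vᵀ) +
    (2 * dissipation V) • (1 : Matrix (Fin d) (Fin d) ℝ)

/-- The part of the derivative of `errF` that is not damping. -/
noncomputable def forceF (V : Matrix (Fin d) (Fin n) ℝ) : Matrix (Fin n) (Fin n) ℝ :=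
  Matrix.diagonal fun j ↦
    -(2 * n * (V.col j ⬝ᵥ errE V *ᵥ V.col j)) - 2 * colErr V j ^ 2 + 2 * dissipation V

/-- Substituting `d V Vᵀ = errE V + size V • 1` on both sides of `errE V` yields the damping and the
quadratic term. The column errors enter linearly only through `d V (errF V) Vᵀ`, the term that
expansion controls. -/
theorem hasDerivWithinAt_errE {Vt : ℝ → Matrix (Fin d) (Fin n) ℝ} {s : Set ℝ} {t : ℝ}
    (h : HasDerivWithinAt Vt (field (Vt t)) s t) :
    HasDerivWithinAt (fun u ↦ errE (Vt u))
      (-((2 * size (Vt t)) • errE (Vt t)) + forceE (Vt t)) s t := by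
  unfold errE
  refine (((HasDerivWithinAt.matrix_mul h (HasDerivWithinAt.matrix_transpose h)).const_smul
    (d : ℝ)).sub ((hasDerivWithinAt_size h).smul_const _)).congr_deriv ?_
  change _ = -((2 * size (Vt t)) • errE (Vt t)) + forceE (Vt t)
  generalize Vt t = V
  have hF : (errF V)ᵀ = errF V := by rw [errF_eq, Matrix.diagonal_transpose]
  have hL : (d : ℝ) • (errE V * (V * Vᵀ)) = errE V * errE V + size V • errE V := by
    rw [← Matrix.mul_smul, smul_mul_transpose, Matrix.mul_add, Matrix.mul_smul, Matrix.mul_one]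
  have hR : (d : ℝ) • ((V * Vᵀ) * errE V) = errE V * errE V + size V • errE V := by
    rw [← Matrix.smul_mul, smul_mul_transpose, Matrix.add_mul, Matrix.smul_mul, Matrix.one_mul]
  have hfield : (d : ℝ) • (field V * Vᵀ + V * (field V)ᵀ) =
      -((d : ℝ) • (errE V * (V * Vᵀ)) + (d : ℝ) • ((V * Vᵀ) * errE V) +
        (2 * d : ℝ) • (V * errF V * Vᵀ)) := by
    simp only [field, Matrix.transpose_neg, Matrix.transpose_add, Matrix.transpose_mul,
      errE_isSymm, hF, Matrix.neg_mul, Matrix.mul_neg, Matrix.add_mul, Matrix.mul_add,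
      Matrix.mul_assoc]
    module
  rw [hfield, hL, hR, forceE]
  module

theorem hasDerivWithinAt_errF {Vt : ℝ → Matrix (Fin d) (Fin n) ℝ} {s : Set ℝ} {t : ℝ}
    (h : HasDerivWithinAt Vt (field (Vt t)) s t) :
    HasDerivWithinAt (fun u ↦ errF (Vt u))
      (-((2 * size (Vt t)) • errF (Vt t)) + forceF (Vt t)) s t := by
  have hcol : ∀ j, HasDerivWithinAt (fun u ↦ colErr (Vt u) j)
      (-(2 * size (Vt t)) * colErr (Vt t) j + (-(2 * n * ((Vt t).col j ⬝ᵥ errE (Vt t) *ᵥ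
        (Vt t).col j)) - 2 * colErr (Vt t) j ^ 2 + 2 * dissipation (Vt t))) s t := by
    intro j
    have hij := hasDerivWithinAt_matrix_iff.1 h
    have hsum : HasDerivWithinAt (fun u ↦ ∑ i, Vt u i j ^ 2)
        (∑ i, 2 * (Vt t i j * field (Vt t) i j)) s t :=
      HasDerivWithinAt.fun_sum fun i _ ↦ ((hij i j).pow 2).congr_deriv (by simp; ring)
    refine ((hsum.const_mul (n : ℝ)).sub (hasDerivWithinAt_size h)).congr_deriv ?_
    generalize Vt t = V
    have h1 : ∑ i, 2 * (V i j * field V i j) =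
        -2 * (V.col j ⬝ᵥ errE V *ᵥ V.col j) - 2 * colErr V j * ∑ i, V i j ^ 2 := by
      simp only [dotProduct, Finset.mul_sum, ← Finset.sum_sub_distrib]
      refine Finset.sum_congr rfl fun i _ ↦ ?_
      have h2 : (errE V *ᵥ V.col j) i = (errE V * V) i j := rfl
      rw [h2, field, errF_eq, Matrix.neg_apply, Matrix.add_apply, Matrix.mul_diagonal,
        Matrix.col_apply]
      ring
    rw [h1]
    unfold colErr
    ring
  simp only [errF_eq]
  refine (HasDerivWithinAt.matrix_diagonal hcol).congr_deriv ?_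
  rw [forceF, ← Matrix.diagonal_smul, Matrix.diagonal_neg, Matrix.diagonal_add]
  congr 1
  ext j
  simp

theorem sum_smul_vecMulVec_col (V : Matrix (Fin d) (Fin n) ℝ) (y : Fin n → ℝ) :
    ∑ j, y j • Matrix.vecMulVec (V.col j) (V.col j) = V * Matrix.diagonal y * Vᵀ := by
  ext i k
  rw [Matrix.mul_apply]
  simp only [Matrix.sum_apply, Matrix.smul_apply, Matrix.vecMulVec_apply, Matrix.mul_diagonal,
    Matrix.col_apply, Matrix.transpose_apply, smul_eq_mul]
  exact Finset.sum_congr rfl fun j _ ↦ by ring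

/-! ### Norm estimates -/

/-- The column errors sum to zero, so after division by `‖errF V‖` they are an admissible `y` in the
definition of expansion. -/
theorem norm_smul_mul_errF_mul_transpose_le {V : Matrix (Fin d) (Fin n) ℝ} {α : ℝ} (hd : 0 < d)
    (hV : InftyExpansion V α) :
    ‖(d : ℝ) • (V * errF V * Vᵀ)‖ ≤ size V * α * ‖errF V‖ := by
  have hd' : (0 : ℝ) < d := by exact_mod_cast hd
  rcases eq_or_ne (errF V) 0 with h0 | h0
  · simp [h0]
  have hpos : 0 < ‖errF V‖ := norm_pos_iff.2 h0
  have h1 := hV (fun j ↦ ‖errF V‖⁻¹ * colErr V j) (by rw [← Finset.mul_sum, sum_colErr, mul_zero])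
    fun j ↦ by
      rw [abs_mul, abs_of_pos (inv_pos.2 hpos), inv_mul_le_iff₀ hpos, mul_one]
      exact abs_colErr_le V j
  have h2 : V * Matrix.diagonal (fun j ↦ ‖errF V‖⁻¹ * colErr V j) * Vᵀ =
      ‖errF V‖⁻¹ • (V * errF V * Vᵀ) := by
    rw [← Matrix.smul_mul, ← Matrix.mul_smul, errF_eq, ← Matrix.diagonal_smul]
    rfl
  rw [sum_smul_vecMulVec_col, h2, norm_smul, norm_inv, norm_norm, inv_mul_le_iff₀ hpos] at h1
  rw [norm_smul, Real.norm_eq_abs, abs_of_pos hd']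
  calc (d : ℝ) * ‖V * errF V * Vᵀ‖ ≤ d * (‖errF V‖ * (size V * α / d)) := by gcongr
    _ = size V * α * ‖errF V‖ := by field_simp

theorem norm_forceE_le {V : Matrix (Fin d) (Fin n) ℝ} {α : ℝ} (hd : 0 < d)
    (hV : InftyExpansion V α) :
    ‖forceE V‖ ≤ 4 * ‖errE V‖ ^ 2 + 2 * ‖errF V‖ ^ 2 + 2 * (size V * α * ‖errF V‖) := by
  have h1 := norm_smul_mul_errF_mul_transpose_le hd hV
  have h2 : ‖(2 : ℝ) • (errE V * errE V)‖ ≤ 2 * ‖errE V‖ ^ 2 := by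
    rw [norm_smul, Real.norm_two, sq]
    gcongr
    exact Matrix.l2_opNorm_mul _ _
  have h3 : ‖(2 * d : ℝ) • (V * errF V * Vᵀ)‖ ≤ 2 * (size V * α * ‖errF V‖) := by
    rw [mul_smul, norm_smul, Real.norm_two]
    gcongr
  have h4 : ‖(2 * dissipation V) • (1 : Matrix (Fin d) (Fin d) ℝ)‖ ≤
      2 * (‖errE V‖ ^ 2 + ‖errF V‖ ^ 2) := by
    have := dissipation_nonneg V
    rw [norm_smul, Real.norm_eq_abs, abs_of_nonneg (by positivity)]
    calc _ ≤ 2 * dissipation V * 1 := by gcongr; exact l2_opNorm_one_le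
      _ ≤ _ := by rw [mul_one]; gcongr; exact dissipation_le V
  unfold forceE
  refine (norm_add_le _ _).trans ((add_le_add_left (norm_sub_le _ _) _).trans ?_)
  rw [norm_neg]
  linarith

/-- The coupling is estimated through `n ‖v_j‖² = size V + colErr V j` alone. It has the full
coefficient `2 * size V`, with no gain from expansion. -/
theorem norm_forceF_le (V : Matrix (Fin d) (Fin n) ℝ) :
    ‖forceF V‖ ≤ 2 * ‖errE V‖ * (size V + ‖errF V‖) + 2 * ‖errE V‖ ^ 2 + 4 * ‖errF V‖ ^ 2 := by
  have hs := size_nonneg V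
  rw [forceF, Matrix.l2_opNorm_diagonal, pi_norm_le_iff_of_nonneg (by positivity)]
  intro j
  have h1 := abs_dotProduct_mulVec_le (errE V) (V.col j)
  have h2 := abs_colErr_le V j
  have h3 := dissipation_nonneg V
  have h4 := dissipation_le V
  have h5 : colErr V j ^ 2 ≤ ‖errF V‖ ^ 2 := by
    rw [← sq_abs]
    gcongr
  have h6 : (n : ℝ) * ∑ i, (V.col j) i ^ 2 = size V + colErr V j := by
    simp [colErr]
  have h7 : |n * (V.col j ⬝ᵥ errE V *ᵥ V.col j)| ≤ ‖errE V‖ * (size V + ‖errF V‖) := by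
    rw [abs_mul, Nat.abs_cast]
    calc _ ≤ n * (‖errE V‖ * ∑ i, (V.col j) i ^ 2) := by gcongr
      _ = ‖errE V‖ * (size V + colErr V j) := by rw [← h6]; ring
      _ ≤ _ := by gcongr; exact (le_abs_self _).trans h2
  rw [Real.norm_eq_abs]
  rw [abs_le] at h7 ⊢
  constructor <;> nlinarith [sq_nonneg (colErr V j)]

theorem norm_mul_transpose_le {V : Matrix (Fin d) (Fin n) ℝ} {ε : ℝ} (hd : 0 < d)
    (hV : DoublyBalanced V ε) : ‖V‖ * ‖V‖ ≤ size V * (1 + ε) / d := by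
  have hd' : (0 : ℝ) < d := by exact_mod_cast hd
  have h1 : ‖errE V‖ ≤ size V * ε := (le_max_left _ _).trans hV
  have h2 : ‖(d : ℝ) • (V * Vᵀ)‖ ≤ size V * ε + size V := by
    rw [smul_mul_transpose]
    refine (norm_add_le _ _).trans (add_le_add h1 ?_)
    rw [norm_smul, Real.norm_eq_abs, abs_of_nonneg (size_nonneg V)]
    exact mul_le_of_le_one_right (size_nonneg V) l2_opNorm_one_le
  rw [norm_smul, Real.norm_eq_abs, abs_of_pos hd', l2_opNorm_mul_transpose_self] at h2
  rw [le_div_iff₀ hd']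
  linarith

theorem abs_diag_sub_one_le {R : Matrix (Fin n) (Fin n) ℝ} {δ : ℝ} (hR : ‖R - 1‖ ≤ δ) (j : Fin n) :
    |R j j - 1| ≤ δ := by
  simpa using (abs_diag_le_l2_opNorm (R - 1) j).trans hR

theorem norm_le_one_add_of_norm_sub_one_le {L : Matrix (Fin n) (Fin n) ℝ} {δ : ℝ}
    (hL : ‖L - 1‖ ≤ δ) : ‖L‖ ≤ 1 + δ := by
  calc ‖L‖ = ‖1 + (L - 1)‖ := by rw [add_sub_cancel]
    _ ≤ ‖(1 : Matrix (Fin n) (Fin n) ℝ)‖ + ‖L - 1‖ := norm_add_le _ _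
    _ ≤ 1 + δ := add_le_add l2_opNorm_one_le hL

/-- `∞`-expansion is stable under scalings that are close to the identity. -/
theorem InftyExpansion.scaling {V : Matrix (Fin d) (Fin n) ℝ} {ε lam : ℝ} (hd : 0 < d)
    (hε : ε ≤ 1) (hlam : 0 < lam) (hlam1 : lam ≤ 1) (hB : DoublyBalanced V ε)
    (hV : InftyExpansion V (1 - lam)) {L : Matrix (Fin d) (Fin d) ℝ}
    {R : Matrix (Fin n) (Fin n) ℝ} (hRd : R.IsDiag) (hL : ‖L - 1‖ ≤ lam / 40)
    (hR : ‖R - 1‖ ≤ lam / 40) (hs : size V * (1 - lam / 10) ≤ size (L * V * R)) :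
    InftyExpansion (L * V * R) (1 - lam / 2) := by
  intro y hy0 hy1
  have hd' : (0 : ℝ) < d := by exact_mod_cast hd
  have hs0 := size_nonneg V
  have hLn := norm_le_one_add_of_norm_sub_one_le hL
  -- The perturbation of `y` caused by `R`. It need not sum to zero, so its contribution is bounded
  -- by `‖V‖² ‖z‖`, using double balance instead of expansion.
  let z : Fin n → ℝ := fun j ↦ y j * (R j j ^ 2 - 1)
  have hz : ‖z‖ ≤ lam / 20 + lam ^ 2 / 1600 := by
    rw [pi_norm_le_iff_of_nonneg (by positivity)]
    intro j
    have h1 := abs_diag_sub_one_le hR j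
    have h2 : R j j ^ 2 - 1 = (R j j - 1) * ((R j j - 1) + 2) := by ring
    rw [Real.norm_eq_abs, abs_mul, h2, abs_mul]
    have h3 : |R j j - 1 + 2| ≤ lam / 40 + 2 := (abs_add_le _ _).trans (by simpa using h1)
    calc _ ≤ 1 * (lam / 40 * (lam / 40 + 2)) := by
          gcongr
          exact hy1 j
      _ = _ := by ring
  have hdec : (L * V * R) * Matrix.diagonal y * (L * V * R)ᵀ =
      L * (V * Matrix.diagonal y * Vᵀ + V * Matrix.diagonal z * Vᵀ) * Lᵀ := by
    have h1 : R * Matrix.diagonal y * Rᵀ = Matrix.diagonal y + Matrix.diagonal z := by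
      rw [← hRd.diagonal_diag, Matrix.diagonal_transpose, Matrix.diagonal_mul_diagonal,
        Matrix.diagonal_mul_diagonal, Matrix.diagonal_add]
      congr 1
      ext j
      simp [z]
      ring
    rw [← Matrix.add_mul, ← Matrix.mul_add, ← h1]
    simp only [Matrix.transpose_mul, Matrix.mul_assoc]
  have h1 : ‖V * Matrix.diagonal y * Vᵀ‖ ≤ size V * (1 - lam) / d := by
    rw [← sum_smul_vecMulVec_col]
    exact hV y hy0 hy1
  have h2 : ‖V * Matrix.diagonal z * Vᵀ‖ ≤ size V * (1 + 1) / d * (lam / 20 + lam ^ 2 / 1600) := by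
    calc ‖V * Matrix.diagonal z * Vᵀ‖ ≤ ‖V‖ * ‖z‖ * ‖V‖ := by
          refine (Matrix.l2_opNorm_mul _ _).trans ?_
          rw [l2_opNorm_transpose]
          gcongr
          exact (Matrix.l2_opNorm_mul _ _).trans (by rw [Matrix.l2_opNorm_diagonal])
      _ = ‖V‖ * ‖V‖ * ‖z‖ := by ring
      _ ≤ _ := by
          gcongr
          refine (norm_mul_transpose_le hd hB).trans ?_
          gcongr
  have h3 : ‖L * (V * Matrix.diagonal y * Vᵀ + V * Matrix.diagonal z * Vᵀ) * Lᵀ‖ ≤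
      (1 + lam / 40) * (size V * (1 - lam) / d +
        size V * (1 + 1) / d * (lam / 20 + lam ^ 2 / 1600)) * (1 + lam / 40) := by
    refine (Matrix.l2_opNorm_mul _ _).trans ?_
    rw [l2_opNorm_transpose]
    have := sub_nonneg.2 hlam1
    gcongr
    refine (Matrix.l2_opNorm_mul _ _).trans ?_
    gcongr
    exact (norm_add_le _ _).trans (add_le_add h1 h2)
  rw [sum_smul_vecMulVec_col, hdec]
  refine h3.trans ?_
  -- To first order the left side is `1 - 0.85 lam` and the right side `1 - 0.6 lam`.
  have hreal : (1 + lam / 40) * ((1 - lam) + 2 * (lam / 20 + lam ^ 2 / 1600)) * (1 + lam / 40) ≤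
      (1 - lam / 10) * (1 - lam / 2) := by
    have hsq : lam ^ 2 ≤ lam := by nlinarith
    have hA : (1 + lam / 40) ^ 2 ≤ 1 + lam * (6 / 100) := by nlinarith
    have hB1 : (1 - lam) + 2 * (lam / 20 + lam ^ 2 / 1600) ≤ 1 - lam * (89 / 100) := by nlinarith
    have hB0 : 0 ≤ 1 - lam * (89 / 100) := by linarith
    calc _ = (1 + lam / 40) ^ 2 * ((1 - lam) + 2 * (lam / 20 + lam ^ 2 / 1600)) := by ring
      _ ≤ (1 + lam * (6 / 100)) * (1 - lam * (89 / 100)) := by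
          gcongr
      _ ≤ _ := by nlinarith
  calc _ = size V / d * ((1 + lam / 40) * ((1 - lam) + 2 * (lam / 20 + lam ^ 2 / 1600)) *
        (1 + lam / 40)) := by ring
    _ ≤ size V / d * ((1 - lam / 10) * (1 - lam / 2)) := by gcongr
    _ = size V * (1 - lam / 10) * (1 - lam / 2) / d := by ring
    _ ≤ _ := by
      have : 0 ≤ 1 - lam / 2 := by linarith
      gcongr

/-! ### The flow -/

theorem IsFrame.exists_rightInverse {V : Matrix (Fin d) (Fin n) ℝ} (hV : IsFrame V) :
    ∃ W : Matrix (Fin n) (Fin d) ℝ, V * W = 1 := by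
  rw [← Matrix.mulVec_surjective_iff_exists_right_inverse]
  have h : LinearMap.range V.mulVecLin = ⊤ := by rw [Matrix.range_mulVecLin]; exact hV
  exact LinearMap.range_eq_top.1 h

theorem IsFrame.size_pos {V : Matrix (Fin d) (Fin n) ℝ} (hV : IsFrame V) (hd : 0 < d) :
    0 < size V := by
  obtain ⟨W, hW⟩ := hV.exists_rightInverse
  refine (size_nonneg V).lt_of_ne' fun h ↦ ?_
  have hV0 : V = 0 := by
    ext i j
    have h1 := (Finset.sum_eq_zero_iff_of_nonneg fun i _ ↦
      Finset.sum_nonneg fun j _ ↦ sq_nonneg (V i j)).1 h i (Finset.mem_univ i)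
    have h2 := (Finset.sum_eq_zero_iff_of_nonneg fun j _ ↦ sq_nonneg (V i j)).1 h1 j
      (Finset.mem_univ j)
    simpa using h2
  have := congrFun (congrFun hW ⟨0, hd⟩) ⟨0, hd⟩
  simp [hV0] at this

theorem exists_curve (V : Matrix (Fin d) (Fin n) ℝ) :
    ∃ Vt : ℝ → Matrix (Fin d) (Fin n) ℝ, Vt 0 = V ∧
      ∀ t, 0 ≤ t → HasDerivWithinAt Vt (field (Vt t)) (Set.Ici 0) t := by
  let v : (Fin d → Fin n → ℝ) → Fin d → Fin n → ℝ := fun x ↦ field (Matrix.of x)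
  let g : (Fin d → Fin n → ℝ) → ℝ := fun x ↦ size (Matrix.of x)
  have hg : ContDiff ℝ 1 g := by
    simp only [g, size, Matrix.of_apply]
    fun_prop
  have hv : ContDiff ℝ 1 v := by
    refine contDiff_pi.2 fun i ↦ contDiff_pi.2 fun j ↦ ?_
    have hE : ∀ k, ContDiff ℝ 1 fun x : Fin d → Fin n → ℝ ↦ errE (Matrix.of x) i k := fun k ↦ by
      simp only [errE, Matrix.sub_apply, Matrix.smul_apply, Matrix.mul_apply,
        Matrix.transpose_apply, Matrix.of_apply, smul_eq_mul]
      exact ContDiff.sub (by fun_prop) (hg.mul contDiff_const)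
    have hF : ContDiff ℝ 1 fun x : Fin d → Fin n → ℝ ↦ colErr (Matrix.of x) j := by
      simp only [colErr, Matrix.of_apply]
      exact ContDiff.sub (by fun_prop) hg
    have heq : (fun x : Fin d → Fin n → ℝ ↦ v x i j) = fun x ↦
        -(∑ k, errE (Matrix.of x) i k * x k j + x i j * colErr (Matrix.of x) j) := by
      ext x
      simp only [v, field, errF_eq, Matrix.neg_apply, Matrix.add_apply, Matrix.mul_diagonal]
      rw [Matrix.mul_apply]
      rfl
    rw [heq]
    fun_prop
  have hdec : ∀ x, fderiv ℝ g x (v x) ≤ 0 := by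
    intro x
    -- The derivative of the size in the direction `v x` is computed along a straight line:
    -- `hasDerivWithinAt_size` needs the velocity at one time only.
    have hc : HasDerivAt (fun u : ℝ ↦ x + u • v x) (v x) 0 := by
      simpa using ((hasDerivAt_id (0 : ℝ)).smul_const (v x)).const_add x
    have h1 : HasDerivAt (fun u : ℝ ↦ g (x + u • v x)) (fderiv ℝ g x (v x)) 0 := by
      have hx : HasFDerivAt g (fderiv ℝ g x) (x + (0 : ℝ) • v x) := by
        simpa using (hg.differentiable one_ne_zero x).hasFDerivAt
      exact hx.comp_hasDerivAt (0 : ℝ) hc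
    have h2 := hasDerivWithinAt_size (Vt := fun u : ℝ ↦ Matrix.of (x + u • v x)) (s := Set.univ)
      (t := 0) (by simp only [zero_smul, add_zero]; exact hc.hasDerivWithinAt)
    have h3 := h1.unique (hasDerivWithinAt_univ.1 h2)
    rw [h3]
    have := dissipation_nonneg (Matrix.of (x + (0 : ℝ) • v x))
    linarith
  have hbdd : Bornology.IsBounded {x | g x ≤ g V} := by
    refine (Metric.isBounded_closedBall (x := (0 : Fin d → Fin n → ℝ))
      (r := √(g V))).subset fun x hx ↦ ?_
    rw [mem_closedBall_zero_iff, pi_norm_le_iff_of_nonneg (Real.sqrt_nonneg _)]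
    intro i
    rw [pi_norm_le_iff_of_nonneg (Real.sqrt_nonneg _)]
    intro j
    refine Real.abs_le_sqrt (le_trans ?_ hx)
    calc x i j ^ 2 ≤ ∑ j, x i j ^ 2 :=
          Finset.single_le_sum (f := fun j ↦ x i j ^ 2) (fun j _ ↦ sq_nonneg _) (Finset.mem_univ j)
      _ ≤ ∑ i, ∑ j, x i j ^ 2 :=
          Finset.single_le_sum (f := fun i ↦ ∑ j, x i j ^ 2)
            (fun i _ ↦ Finset.sum_nonneg fun j _ ↦ sq_nonneg _) (Finset.mem_univ i)
  obtain ⟨α, h0, hα⟩ := exists_integralCurve_of_antitone hv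
    (fun x ↦ (hg.differentiable one_ne_zero x).hasFDerivAt) hdec V hbdd
  exact ⟨fun t ↦ Matrix.of (α t), h0, fun t ht ↦ (hα t ht).hasDerivWithinAt⟩

/-- `R_t` is an explicit exponential because its equation is diagonal. With a right inverse `W` of
`V`, the choice `L_t = V_t R_t⁻¹ W` starts at the identity, and the `errF` terms cancel in its
derivative. -/
theorem IsFrame.exists_isFlow {V : Matrix (Fin d) (Fin n) ℝ} (hV : IsFrame V) :
    ∃ Vt Lt Rt, IsFlow V Vt Lt Rt := by
  obtain ⟨W, hW⟩ := hV.exists_rightInverse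
  obtain ⟨Vt, h0, hVt⟩ := exists_curve V
  let f : Fin n → ℝ → ℝ := fun j t ↦ colErr (Vt (max t 0)) j
  have hVc : Continuous fun t : ℝ ↦ Vt (max t 0) :=
    ContinuousOn.comp_continuous (s := Set.Ici 0) (fun t ht ↦ (hVt t ht).continuousWithinAt)
      (by fun_prop) fun t ↦ le_max_right t 0
  have hfc : ∀ j, Continuous (f j) := fun j ↦ by
    have hcol : Continuous fun V : Matrix (Fin d) (Fin n) ℝ ↦ colErr V j := by
      unfold colErr; fun_prop
    exact hcol.comp hVc
  let S : Fin n → ℝ → ℝ := fun j t ↦ ∫ u in (0 : ℝ)..t, f j u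
  have hS : ∀ j t, 0 ≤ t → HasDerivWithinAt (S j) (colErr (Vt t) j) (Set.Ici 0) t := by
    intro j t ht
    have := (intervalIntegral.integral_hasDerivAt_right ((hfc j).intervalIntegrable 0 t)
      ((hfc j).stronglyMeasurableAtFilter _ _) (hfc j).continuousAt).hasDerivWithinAt
      (s := Set.Ici 0)
    simpa [f, max_eq_left ht] using this
  have hR : ∀ t, 0 ≤ t → HasDerivWithinAt (fun t ↦ Matrix.diagonal fun j ↦ Real.exp (-S j t))
      (-((Matrix.diagonal fun j ↦ Real.exp (-S j t)) * errF (Vt t))) (Set.Ici 0) t := by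
    intro t ht
    refine (HasDerivWithinAt.matrix_diagonal fun j ↦ (hS j t ht).fun_neg.exp).congr_deriv ?_
    rw [errF_eq, Matrix.diagonal_mul_diagonal, Matrix.diagonal_neg]
    simp
  have hRi : ∀ t, 0 ≤ t → HasDerivWithinAt (fun t ↦ Matrix.diagonal fun j ↦ Real.exp (S j t))
      (errF (Vt t) * (Matrix.diagonal fun j ↦ Real.exp (S j t))) (Set.Ici 0) t := by
    intro t ht
    refine (HasDerivWithinAt.matrix_diagonal fun j ↦ (hS j t ht).exp).congr_deriv ?_
    rw [errF_eq, Matrix.diagonal_mul_diagonal]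
    simp [mul_comm]
  refine ⟨Vt, fun t ↦ Vt t * (Matrix.diagonal fun j ↦ Real.exp (S j t)) * W,
    fun t ↦ Matrix.diagonal fun j ↦ Real.exp (-S j t), h0, ?_, ?_, hVt, fun t ht ↦ ?_, hR⟩
  · simp [S, h0, hW]
  · simp [S]
  · refine (HasDerivWithinAt.matrix_mul (HasDerivWithinAt.matrix_mul (hVt t ht) (hRi t ht))
      (hasDerivWithinAt_const t (Set.Ici 0) W)).congr_deriv ?_
    simp only [field, Matrix.mul_zero, add_zero, ← Matrix.add_mul, ← Matrix.mul_assoc,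
      ← Matrix.neg_mul]
    congr 2
    rw [Matrix.neg_mul]
    abel

section Flow

variable {V : Matrix (Fin d) (Fin n) ℝ} {Vt : ℝ → Matrix (Fin d) (Fin n) ℝ}
  {Lt : ℝ → Matrix (Fin d) (Fin d) ℝ} {Rt : ℝ → Matrix (Fin n) (Fin n) ℝ}

theorem IsFlow.continuousOn (h : IsFlow V Vt Lt Rt) : ContinuousOn Vt (Set.Ici 0) :=
  fun t ht ↦ (h.deriv_V t ht).continuousWithinAt

/-- Each entry of `R_t` solves a scalar homogeneous linear equation, so an entry that starts at zero
stays zero. -/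
theorem IsFlow.isDiag (h : IsFlow V Vt Lt Rt) {t : ℝ} (ht : 0 ≤ t) : (Rt t).IsDiag := by
  intro i j hij
  refine eq_zero_of_norm_deriv_le_mul (f := fun t ↦ Rt t i j)
    (f' := fun t ↦ -(Rt t i j * colErr (Vt t) j)) (k := fun t ↦ ‖errF (Vt t)‖)
    (continuous_errF.norm.comp_continuousOn h.continuousOn) (fun t ht ↦ ?_) ?_ (fun t ht ↦ ?_) t ht
  · refine (hasDerivWithinAt_matrix_iff.1 (h.deriv_R t ht) i j).congr_deriv ?_
    rw [errF_eq, Matrix.neg_apply, Matrix.mul_diagonal]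
  · simp [h.init_R, hij]
  · rw [norm_neg, norm_mul, mul_comm]
    gcongr
    exact abs_colErr_le _ _

/-- The difference `D` of the two sides solves `D' = -(E D + D F)` with `D = 0` initially. -/
theorem IsFlow.eq_mul (h : IsFlow V Vt Lt Rt) {t : ℝ} (ht : 0 ≤ t) : Vt t = Lt t * V * Rt t := by
  rw [← sub_eq_zero]
  refine eq_zero_of_norm_deriv_le_mul (f := fun t ↦ Vt t - Lt t * V * Rt t)
    (f' := fun t ↦ -(errE (Vt t) * (Vt t - Lt t * V * Rt t) +
      (Vt t - Lt t * V * Rt t) * errF (Vt t)))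
    (k := fun t ↦ ‖errE (Vt t)‖ + ‖errF (Vt t)‖)
    ((continuous_errE.norm.add continuous_errF.norm).comp_continuousOn h.continuousOn)
    (fun t ht ↦ ?_) ?_ (fun t ht ↦ ?_) t ht
  · refine ((h.deriv_V t ht).sub (HasDerivWithinAt.matrix_mul (HasDerivWithinAt.matrix_mul
      (h.deriv_L t ht) (hasDerivWithinAt_const t (Set.Ici 0) V)) (h.deriv_R t ht))).congr_deriv ?_
    simp only [Matrix.mul_zero, add_zero, Matrix.mul_sub, Matrix.sub_mul, Matrix.neg_mul,
      Matrix.mul_neg, Matrix.mul_assoc]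
    abel
  · simp [h.init_V, h.init_L, h.init_R]
  · rw [norm_neg, add_mul, mul_comm ‖errF (Vt t)‖]
    exact (norm_add_le _ _).trans (add_le_add (Matrix.l2_opNorm_mul _ _)
      (Matrix.l2_opNorm_mul _ _))

end Flow

/-! ### Decay of the errors and the continuity argument. -/

/-- Here `s` and `σ` are the initial and current sizes, `e` and `f` the error norms, and `b` the
barrier. Both `1 / (1 + lam/4)` and `(1 + lam/4)(1 - lam/2)` are at most `1 - lam/6`, so damping
exceeds coupling by `σ lam b / 3`. This pays for the quadratic terms, at most `9 b²`, and for the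
decay of the barrier. -/
theorem force_lt_of_bounds {s ε lam σ b e f : ℝ} (hs : 0 < s) (hε : 0 < ε) (hlam : 0 < lam)
    (hlam1 : lam ≤ 1) (hc : 2000 * ε ≤ lam ^ 2) (hσ : s * (1 - lam / 10) ≤ σ) (hb : 0 < b)
    (hbε : b ≤ 2 * ε * s) (he0 : 0 ≤ e) (hf0 : 0 ≤ f) (he : (1 + lam / 4) * e ≤ b) (hf : f ≤ b) :
    max ((1 + lam / 4) * (4 * e ^ 2 + 2 * f ^ 2 + 2 * (σ * (1 - lam / 2) * f)))
        (2 * e * (σ + f) + 2 * e ^ 2 + 4 * f ^ 2) <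
      2 * σ * b + -(s * lam / 12) * b := by
  have hσ0 : 0 < σ := lt_of_lt_of_le (mul_pos hs (by linarith)) hσ
  have hl0 : 0 ≤ 1 - lam / 6 := by linarith
  have heb : e ≤ (1 - lam / 6) * b := by
    have h1 : 1 ≤ (1 - lam / 6) * (1 + lam / 4) := by nlinarith
    calc e = 1 * e := (one_mul e).symm
      _ ≤ (1 - lam / 6) * (1 + lam / 4) * e := by gcongr
      _ = (1 - lam / 6) * ((1 + lam / 4) * e) := by ring
      _ ≤ _ := by gcongr
  have heb' : e ≤ b := heb.trans (mul_le_of_le_one_left hb.le (by linarith))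
  have hμ : 9 * b + s * lam / 12 < 2 * σ * (lam / 6) := by
    have h0 : ε ≤ lam / 2000 := by nlinarith
    have h1 : ε * s ≤ lam / 2000 * s := by gcongr
    have h2 : s * (9 / 10) * lam ≤ σ * lam := by
      gcongr
      exact le_trans (by gcongr; linarith) hσ
    have h3 : 0 < s * lam := by positivity
    linarith
  have hmain : 2 * σ * (1 - lam / 6) * b + 9 * b ^ 2 < 2 * σ * b + -(s * lam / 12) * b := by
    have := mul_lt_mul_of_pos_right hμ hb
    linarith
  have hee : e ^ 2 ≤ b ^ 2 := by gcongr
  have hff : f ^ 2 ≤ b ^ 2 := by gcongr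
  have hef : e * f ≤ b * b := by gcongr
  refine lt_of_le_of_lt (max_le ?_ ?_) hmain
  · have hcoef : (1 + lam / 4) * (1 - lam / 2) ≤ 1 - lam / 6 := by nlinarith
    have ha1 : 1 + lam / 4 ≤ 5 / 4 := by linarith
    calc _ = (1 + lam / 4) * (4 * e ^ 2 + 2 * f ^ 2) +
          2 * σ * ((1 + lam / 4) * (1 - lam / 2)) * f := by ring
      _ ≤ 5 / 4 * (4 * b ^ 2 + 2 * b ^ 2) + 2 * σ * (1 - lam / 6) * b := by gcongr
      _ ≤ _ := by linarith [sq_nonneg b]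
  · have : σ * e ≤ σ * ((1 - lam / 6) * b) := by gcongr
    linarith [sq_nonneg b]

section Flow

variable {V : Matrix (Fin d) (Fin n) ℝ} {Vt : ℝ → Matrix (Fin d) (Fin n) ℝ}
  {Lt : ℝ → Matrix (Fin d) (Fin d) ℝ} {Rt : ℝ → Matrix (Fin n) (Fin n) ℝ}

/-- If `V_t` is `(1 - lam/2)`-`∞`-expanding and its size stays comparable with that of `V` up to
time `T`, then the errors decay exponentially up to time `T`. -/
theorem IsFlow.errors_le {ε lam T : ℝ} (h : IsFlow V Vt Lt Rt) (hd : 0 < d)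
    (hs0 : 0 < size V) (hε : 0 < ε) (hlam : 0 < lam) (hlam1 : lam ≤ 1)
    (hB : DoublyBalanced V ε) (hc : 2000 * ε ≤ lam ^ 2)
    (hs : ∀ t ∈ Set.Ico 0 T, size V * (1 - lam / 10) ≤ size (Vt t))
    (hX : ∀ t ∈ Set.Ico 0 T, InftyExpansion (Vt t) (1 - lam / 2)) :
    ∀ t ∈ Set.Icc 0 T,
      ‖errE (Vt t)‖ ≤ 2 * ε * size V * Real.exp (-(size V * lam / 12) * t) ∧
      ‖errF (Vt t)‖ ≤ 2 * ε * size V * Real.exp (-(size V * lam / 12) * t) := by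
  set a : ℝ := 1 + lam / 4 with ha
  set μ : ℝ := size V * lam / 12 with hμ
  set B : ℝ → ℝ := fun t ↦ 2 * ε * size V * Real.exp (-μ * t) with hBdef
  have hBderiv : ∀ t, HasDerivAt B (-μ * B t) t := fun t ↦ by
    have h1 : HasDerivAt (fun t : ℝ ↦ -μ * t) (-μ) t := by
      simpa using (hasDerivAt_id t).const_mul (-μ)
    exact (h1.exp.const_mul _).congr_deriv (by simp only [hBdef]; ring)
  have hBpos : ∀ t, 0 < B t := fun t ↦ by positivity
  -- The sup norm of the product space turns the pair into the weighted maximum.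
  have hmax : ∀ t, ‖(a • errE (Vt t), errF (Vt t))‖ = max (a * ‖errE (Vt t)‖) ‖errF (Vt t)‖ := by
    intro t
    rw [Prod.norm_mk, norm_smul, Real.norm_eq_abs, abs_of_pos (by positivity)]
  have hsub : ∀ t, ‖(a • errE (Vt t), errF (Vt t))‖ ≤ B t →
      a * ‖errE (Vt t)‖ ≤ B t ∧ ‖errF (Vt t)‖ ≤ B t := fun t ht ↦ by
    rw [hmax] at ht
    exact max_le_iff.1 ht
  have key := norm_le_of_hasDerivWithinAt_damped (T := T)
    (Φ := fun t ↦ (a • errE (Vt t), errF (Vt t)))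
    (G := fun t ↦ (a • forceE (Vt t), forceF (Vt t)))
    (σ := fun t ↦ 2 * size (Vt t)) (B := B) (B' := fun t ↦ -μ * B t)
    ((continuous_const.mul continuous_size).comp_continuousOn h.continuousOn)
    (fun t ht ↦ by
      have h1 := (hasDerivWithinAt_errE (h.deriv_V t ht)).const_smul a
      have h2 := hasDerivWithinAt_errF (h.deriv_V t ht)
      refine (h1.prodMk h2).congr_deriv ?_
      rw [Prod.smul_mk, Prod.neg_mk, Prod.mk_add_mk]
      congr 1
      module)
    hBderiv
    (by
      obtain ⟨h1, h2⟩ := max_le_iff.1 hB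
      simp only [h.init_V]
      have h3 := hmax 0
      rw [h.init_V] at h3
      have h4 : B 0 = 2 * ε * size V := by simp [hBdef]
      rw [h3, h4, max_le_iff]
      have : 0 < size V * ε := by positivity
      constructor
      -- The factor 2 in the barrier absorbs the weight `a ≤ 5/4`.
      · calc a * ‖errE V‖ ≤ 2 * (size V * ε) := by gcongr; rw [ha]; linarith
          _ = _ := by ring
      · linarith)
    (fun t ht hEq ↦ by
      obtain ⟨he, hf⟩ := hsub t hEq.le
      have hst := hs t ht
      have hE := norm_forceE_le hd (hX t ht)
      have hF := norm_forceF_le (Vt t)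
      have hBt : B t ≤ 2 * ε * size V :=
        mul_le_of_le_one_right (by positivity) (Real.exp_le_one_iff.2 (by
          rw [neg_mul, neg_nonpos]; exact mul_nonneg (by positivity) ht.1))
      refine lt_of_le_of_lt ?_ (force_lt_of_bounds (s := size V) hs0 hε hlam hlam1 hc hst (hBpos t)
        hBt (norm_nonneg _) (norm_nonneg (errF (Vt t))) he hf)
      change ‖(a • forceE (Vt t), forceF (Vt t))‖ ≤ _
      rw [Prod.norm_mk, norm_smul, Real.norm_eq_abs, abs_of_pos (by positivity)]
      gcongr)
  intro t ht
  obtain ⟨h1, h2⟩ := hsub t (key t ht)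
  refine ⟨le_trans ?_ h1, h2⟩
  exact le_mul_of_one_le_left (norm_nonneg _) (by rw [ha]; linarith)

/-- The quantitative behaviour of the flow at every time. -/
theorem IsFlow.bounds_of_pos {ε lam : ℝ} (h : IsFlow V Vt Lt Rt) (hd : 0 < d)
    (hs0 : 0 < size V) (hε : 0 < ε) (hlam : 0 < lam) (hlam1 : lam ≤ 1)
    (hB : DoublyBalanced V ε) (hV : InftyExpansion V (1 - lam)) (hc : 2000 * ε ≤ lam ^ 2) :
    ∀ t, 0 ≤ t →
      ‖Lt t - 1‖ ≤ 48 * (ε / lam) ∧ ‖Rt t - 1‖ ≤ 48 * (ε / lam) ∧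
      ‖errE (Vt t)‖ ≤ 2 * ε * size V * Real.exp (-(size V * lam / 12) * t) ∧
      ‖errF (Vt t)‖ ≤ 2 * ε * size V * Real.exp (-(size V * lam / 12) * t) ∧
      size V * (1 - 96 * (ε ^ 2 / lam)) ≤ size (Vt t) ∧
      InftyExpansion (Vt t) (1 - lam / 2) := by
  have hε1 : ε ≤ lam / 2000 := by nlinarith
  have hμ : 0 < size V * lam / 12 := by positivity
  -- Positivity of `g` says that the scalings and the size are still in the range where expansion is
  -- stable.
  let g : ℝ → ℝ := fun t ↦ min (min (lam / 40 - ‖Lt t - 1‖) (lam / 40 - ‖Rt t - 1‖))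
    (size (Vt t) - size V * (1 - lam / 10))
  have hLc : ContinuousOn Lt (Set.Ici 0) := fun t ht ↦ (h.deriv_L t ht).continuousWithinAt
  have hRc : ContinuousOn Rt (Set.Ici 0) := fun t ht ↦ (h.deriv_R t ht).continuousWithinAt
  have hsc : ContinuousOn (fun t ↦ size (Vt t)) (Set.Ici 0) :=
    continuous_size.comp_continuousOn h.continuousOn
  have hgc : ContinuousOn g (Set.Ici 0) := by fun_prop
  have hgpos : ∀ t, 0 < g t → ‖Lt t - 1‖ ≤ lam / 40 ∧ ‖Rt t - 1‖ ≤ lam / 40 ∧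
      size V * (1 - lam / 10) ≤ size (Vt t) := fun t ht ↦ by
    simp only [g, lt_min_iff] at ht
    exact ⟨by linarith, by linarith, by linarith⟩
  have hexpand : ∀ t, 0 ≤ t → 0 < g t → InftyExpansion (Vt t) (1 - lam / 2) := fun t ht hg ↦ by
    obtain ⟨h1, h2, h3⟩ := hgpos t hg
    rw [h.eq_mul ht] at h3 ⊢
    exact hV.scaling hd (by linarith) hlam hlam1 hB (h.isDiag ht) h1 h2 h3
  have hstep : ∀ T, 0 ≤ T → (∀ u ∈ Set.Ico 0 T, 0 < g u) →
      ‖Lt T - 1‖ ≤ 48 * (ε / lam) ∧ ‖Rt T - 1‖ ≤ 48 * (ε / lam) ∧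
      ‖errE (Vt T)‖ ≤ 2 * ε * size V * Real.exp (-(size V * lam / 12) * T) ∧
      ‖errF (Vt T)‖ ≤ 2 * ε * size V * Real.exp (-(size V * lam / 12) * T) ∧
      size V * (1 - 96 * (ε ^ 2 / lam)) ≤ size (Vt T) := by
    intro T hT hg
    have herr := h.errors_le hd hs0 hε hlam hlam1 hB hc
      (fun t ht ↦ (hgpos t (hg t ht)).2.2) (fun t ht ↦ hexpand t ht.1 (hg t ht))
    refine ⟨?_, ?_, (herr T ⟨hT, le_rfl⟩).1, (herr T ⟨hT, le_rfl⟩).2, ?_⟩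
    -- With `‖Lt t‖ ≤ 2` the integral is `4 ε s / (s lam / 12) = 48 ε / lam`.
    · have h1 := norm_sub_le_of_norm_deriv_le_exp_zero (K := 4 * ε * size V) hμ (by positivity)
        h.deriv_L (fun t ht ↦ by
          have hL := norm_le_one_add_of_norm_sub_one_le (hgpos t (hg t ht)).1
          have hE := (herr t (Set.Ico_subset_Icc_self ht)).1
          rw [norm_neg]
          calc _ ≤ ‖errE (Vt t)‖ * ‖Lt t‖ := Matrix.l2_opNorm_mul _ _
            _ ≤ (2 * ε * size V * Real.exp (-(size V * lam / 12) * t)) * 2 := by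
                gcongr
                linarith
            _ = _ := by ring) hT
      rw [h.init_L] at h1
      refine h1.trans_eq ?_
      field_simp
      norm_num
    · have h1 := norm_sub_le_of_norm_deriv_le_exp_zero (K := 4 * ε * size V) hμ (by positivity)
        h.deriv_R (fun t ht ↦ by
          have hR := norm_le_one_add_of_norm_sub_one_le (hgpos t (hg t ht)).2.1
          have hF := (herr t (Set.Ico_subset_Icc_self ht)).2
          rw [norm_neg]
          calc _ ≤ ‖Rt t‖ * ‖errF (Vt t)‖ := Matrix.l2_opNorm_mul _ _
            _ ≤ 2 * (2 * ε * size V * Real.exp (-(size V * lam / 12) * t)) := by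
                gcongr
                linarith
            _ = _ := by ring) hT
      rw [h.init_R] at h1
      refine h1.trans_eq ?_
      field_simp
      norm_num
    -- The dissipation is quadratic in the errors, so it decays at twice their rate and costs only
    -- order `ε ^ 2 / lam`.
    · have h1 := norm_sub_le_of_norm_deriv_le_exp_zero (K := 16 * ε ^ 2 * size V ^ 2)
        (μ := size V * lam / 6) (by positivity) (by positivity)
        (fun t ht ↦ hasDerivWithinAt_size (h.deriv_V t ht)) (fun t ht ↦ by
          obtain ⟨hE, hF⟩ := herr t (Set.Ico_subset_Icc_self ht)
          have hD := dissipation_le (Vt t)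
          have hD0 := dissipation_nonneg (Vt t)
          rw [norm_neg, Real.norm_eq_abs, abs_of_nonneg (by positivity)]
          calc _ ≤ 2 * ((2 * ε * size V * Real.exp (-(size V * lam / 12) * t)) ^ 2 +
                (2 * ε * size V * Real.exp (-(size V * lam / 12) * t)) ^ 2) := by
                refine mul_le_mul_of_nonneg_left (hD.trans ?_) (by norm_num)
                gcongr
            _ = 16 * ε ^ 2 * size V ^ 2 * Real.exp (-(size V * lam / 12) * t) ^ 2 := by ring
            _ = _ := by
                rw [← Real.exp_nat_mul]
                congr 2
                push_cast
                ring) hT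
      have h2 : 16 * ε ^ 2 * size V ^ 2 / (size V * lam / 6) = size V * (96 * (ε ^ 2 / lam)) := by
        field_simp
        norm_num
      rw [h2, h.init_V, Real.norm_eq_abs, abs_le] at h1
      linarith [h1.1]
  have hall : ∀ t, 0 ≤ t → 0 < g t := by
    refine pos_of_forall_Ico_pos hgc fun T hT hg ↦ ?_
    obtain ⟨h1, h2, -, -, h5⟩ := hstep T hT hg
    -- This amounts to `1920 ε < lam ^ 2`; here the quadratic relation between `ε` and `lam` is
    -- essential.
    have h6 : 48 * (ε / lam) < lam / 40 := by
      rw [← mul_div_assoc, div_lt_iff₀ hlam]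
      nlinarith
    have h7 : 96 * (ε ^ 2 / lam) < lam / 10 := by
      rw [← mul_div_assoc, div_lt_iff₀ hlam]
      nlinarith
    have h8 : size V * (1 - lam / 10) < size V * (1 - 96 * (ε ^ 2 / lam)) := by gcongr
    simp only [g, lt_min_iff]
    exact ⟨⟨by linarith, by linarith⟩, by linarith⟩
  intro t ht
  obtain ⟨h1, h2, h3, h4, h5⟩ := hstep t ht fun u hu ↦ hall u hu.1
  exact ⟨h1, h2, h3, h4, h5, hexpand t ht (hall t ht)⟩

/-- The strict barrier argument needs a positive `ε`. The case `ε = 0` is reached by letting `δ`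
decrease to `ε`; the constant 2001 leaves `2000 * δ ≤ lam ^ 2` for nearby `δ`. -/
theorem IsFlow.bounds {ε lam : ℝ} (h : IsFlow V Vt Lt Rt) (hd : 0 < d)
    (hs0 : 0 < size V) (hε : 0 ≤ ε) (hlam : 0 < lam) (hlam1 : lam ≤ 1)
    (hB : DoublyBalanced V ε) (hV : InftyExpansion V (1 - lam)) (hc : 2001 * ε ≤ lam ^ 2) :
    ∀ t, 0 ≤ t →
      ‖Lt t - 1‖ ≤ 48 * (ε / lam) ∧ ‖Rt t - 1‖ ≤ 48 * (ε / lam) ∧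
      ‖errE (Vt t)‖ ≤ 2 * ε * size V * Real.exp (-(size V * lam / 12) * t) ∧
      ‖errF (Vt t)‖ ≤ 2 * ε * size V * Real.exp (-(size V * lam / 12) * t) ∧
      size V * (1 - 96 * (ε ^ 2 / lam)) ≤ size (Vt t) ∧
      InftyExpansion (Vt t) (1 - lam / 2) := by
  intro t ht
  have hlim : ∀ᶠ δ in 𝓝[>] ε, 0 < δ ∧ DoublyBalanced V δ ∧ 2000 * δ ≤ lam ^ 2 := by
    have hsmall : ∀ᶠ δ in 𝓝 ε, 2000 * δ < lam ^ 2 :=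
      (continuous_const_mul 2000).continuousAt.eventually_lt continuousAt_const
        (by have : 0 < lam ^ 2 := by positivity
            linarith)
    filter_upwards [self_mem_nhdsWithin, hsmall.filter_mono nhdsWithin_le_nhds] with δ hδ hδ'
    exact ⟨hε.trans_lt hδ, le_trans hB (mul_le_mul_of_nonneg_left hδ.le hs0.le), hδ'.le⟩
  have hb := hlim.mono fun δ hδ ↦ h.bounds_of_pos hd hs0 hδ.1 hlam hlam1 hδ.2.1 hV hδ.2.2 t ht
  have lim : ∀ {φ : ℝ → ℝ}, Continuous φ → Tendsto φ (𝓝[>] ε) (𝓝 (φ ε)) := fun hφ ↦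
    hφ.continuousAt.tendsto.mono_left nhdsWithin_le_nhds
  refine ⟨?_, ?_, ?_, ?_, ?_, ?_⟩
  · exact ge_of_tendsto (lim (φ := fun ε ↦ 48 * (ε / lam)) (by fun_prop))
      (hb.mono fun δ hδ ↦ hδ.1)
  · exact ge_of_tendsto (lim (φ := fun ε ↦ 48 * (ε / lam)) (by fun_prop))
      (hb.mono fun δ hδ ↦ hδ.2.1)
  · exact ge_of_tendsto (lim (φ := fun ε ↦ 2 * ε * size V * Real.exp (-(size V * lam / 12) * t))
      (by fun_prop)) (hb.mono fun δ hδ ↦ hδ.2.2.1)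
  · exact ge_of_tendsto (lim (φ := fun ε ↦ 2 * ε * size V * Real.exp (-(size V * lam / 12) * t))
      (by fun_prop)) (hb.mono fun δ hδ ↦ hδ.2.2.2.1)
  · exact le_of_tendsto (lim (φ := fun ε ↦ size V * (1 - 96 * (ε ^ 2 / lam))) (by fun_prop))
      (hb.mono fun δ hδ ↦ hδ.2.2.2.2.1)
  · exact hb.exists.choose_spec.2.2.2.2.2

end Flow

/-! ### Passage to the limit. -/

theorem isScalingSolution_of_errors_eq_zero {V : Matrix (Fin d) (Fin n) ℝ}
    {L : Matrix (Fin d) (Fin d) ℝ} {R : Matrix (Fin n) (Fin n) ℝ} (hR : R.IsDiag)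
    (hE : errE (L * V * R) = 0) (hF : errF (L * V * R) = 0) : IsScalingSolution V L R := by
  refine ⟨hR, ?_, fun j ↦ ?_⟩
  · rcases Nat.eq_zero_or_pos d with rfl | hd
    · exact Subsingleton.elim _ _
    have hd' : (d : ℝ) ≠ 0 := by exact_mod_cast hd.ne'
    have h1 := smul_mul_transpose (L * V * R)
    rw [hE, zero_add] at h1
    rw [div_eq_inv_mul, mul_smul, ← h1, inv_smul_smul₀ hd']
  · have hn' : (n : ℝ) ≠ 0 := by exact_mod_cast j.pos.ne'
    have h1 := abs_colErr_le (L * V * R) j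
    rw [hF, norm_zero] at h1
    have h2 := abs_nonpos_iff.1 h1
    rw [colErr, sub_eq_zero] at h2
    rw [eq_div_iff hn', mul_comm, h2]

theorem isClosed_setOf_inftyExpansion (α : ℝ) :
    IsClosed {V : Matrix (Fin d) (Fin n) ℝ | InftyExpansion V α} := by
  simp only [InftyExpansion, sum_smul_vecMulVec_col, Set.ofPred_forall]
  exact isClosed_iInter fun y ↦ isClosed_iInter fun _ ↦ isClosed_iInter fun _ ↦
    isClosed_le (by fun_prop) (by fun_prop)

theorem isClosed_setOf_isDiag : IsClosed {R : Matrix (Fin n) (Fin n) ℝ | R.IsDiag} := by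
  simp only [Matrix.IsDiag, Pairwise, Set.ofPred_forall]
  exact isClosed_iInter fun i ↦ isClosed_iInter fun j ↦ isClosed_iInter fun _ ↦
    isClosed_eq (by fun_prop) continuous_const

section Limit

variable {V : Matrix (Fin d) (Fin n) ℝ} {Vt : ℝ → Matrix (Fin d) (Fin n) ℝ}
  {Lt : ℝ → Matrix (Fin d) (Fin d) ℝ} {Rt : ℝ → Matrix (Fin n) (Fin n) ℝ}

/-- Convergence of the flow, given the uniform bounds and exponential decay of the errors. -/
theorem IsFlow.exists_limit {K μ δ s α : ℝ} (h : IsFlow V Vt Lt Rt) (hK : 0 ≤ K) (hμ : 0 < μ)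
    (hL : ∀ t, 0 ≤ t → ‖Lt t - 1‖ ≤ δ) (hR : ∀ t, 0 ≤ t → ‖Rt t - 1‖ ≤ δ)
    (hE : ∀ t, 0 ≤ t → ‖errE (Vt t)‖ ≤ K * Real.exp (-μ * t))
    (hF : ∀ t, 0 ≤ t → ‖errF (Vt t)‖ ≤ K * Real.exp (-μ * t))
    (hs : ∀ t, 0 ≤ t → s ≤ size (Vt t)) (hX : ∀ t, 0 ≤ t → InftyExpansion (Vt t) α) :
    ∃ (Linf : Matrix (Fin d) (Fin d) ℝ) (Rinf : Matrix (Fin n) (Fin n) ℝ),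
      Tendsto Lt atTop (𝓝 Linf) ∧ Tendsto Rt atTop (𝓝 Rinf) ∧
      Tendsto Vt atTop (𝓝 (Linf * V * Rinf)) ∧ IsScalingSolution V Linf Rinf ∧
      ‖Linf - 1‖ ≤ δ ∧ ‖Rinf - 1‖ ≤ δ ∧
      InftyExpansion (Linf * V * Rinf) α ∧ s ≤ size (Linf * V * Rinf) := by
  have hδ : 0 ≤ δ := (norm_nonneg _).trans (hL 0 le_rfl)
  have hev : ∀ {p : ℝ → Prop}, (∀ t, 0 ≤ t → p t) → ∀ᶠ t in atTop, p t := fun hp ↦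
    (eventually_ge_atTop 0).mono hp
  obtain ⟨Linf, hLinf⟩ := exists_tendsto_of_norm_deriv_le_exp (K := K * (1 + δ)) hμ (by positivity)
    h.deriv_L fun t ht ↦ by
      rw [norm_neg]
      calc _ ≤ ‖errE (Vt t)‖ * ‖Lt t‖ := Matrix.l2_opNorm_mul _ _
        _ ≤ K * Real.exp (-μ * t) * (1 + δ) := by
            gcongr
            exacts [hE t ht, norm_le_one_add_of_norm_sub_one_le (hL t ht)]
        _ = _ := by ring
  obtain ⟨Rinf, hRinf⟩ := exists_tendsto_of_norm_deriv_le_exp (K := K * (1 + δ)) hμ (by positivity)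
    h.deriv_R fun t ht ↦ by
      rw [norm_neg]
      calc _ ≤ ‖Rt t‖ * ‖errF (Vt t)‖ := Matrix.l2_opNorm_mul _ _
        _ ≤ (1 + δ) * (K * Real.exp (-μ * t)) := by
            gcongr
            exacts [norm_le_one_add_of_norm_sub_one_le (hR t ht), hF t ht]
        _ = _ := by ring
  have hVinf : Tendsto Vt atTop (𝓝 (Linf * V * Rinf)) := by
    have hcont : Continuous fun p : Matrix (Fin d) (Fin d) ℝ × Matrix (Fin n) (Fin n) ℝ ↦
        p.1 * V * p.2 := by fun_prop
    refine ((hcont.tendsto (Linf, Rinf)).comp (hLinf.prodMk_nhds hRinf)).congr' ?_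
    exact hev fun t ht ↦ (h.eq_mul ht).symm
  have hdecay : Tendsto (fun t ↦ K * Real.exp (-μ * t)) atTop (𝓝 0) := by
    have : Tendsto (fun t : ℝ ↦ -μ * t) atTop atBot :=
      tendsto_id.const_mul_atTop_of_neg (by linarith)
    simpa using (Real.tendsto_exp_atBot.comp this).const_mul K
  refine ⟨Linf, Rinf, hLinf, hRinf, hVinf, isScalingSolution_of_errors_eq_zero ?_ ?_ ?_, ?_, ?_,
    ?_, ?_⟩
  · exact isClosed_setOf_isDiag.mem_of_tendsto hRinf (hev fun t ht ↦ h.isDiag ht)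
  · exact tendsto_nhds_unique ((continuous_errE.tendsto _).comp hVinf)
      (squeeze_zero_norm' (hev hE) hdecay)
  · exact tendsto_nhds_unique ((continuous_errF.tendsto _).comp hVinf)
      (squeeze_zero_norm' (hev hF) hdecay)
  · exact le_of_tendsto (hLinf.sub_const 1).norm (hev hL)
  · exact le_of_tendsto (hRinf.sub_const 1).norm (hev hR)
  · exact (isClosed_setOf_inftyExpansion α).mem_of_tendsto hVinf (hev hX)
  · exact ge_of_tendsto ((continuous_size.tendsto _).comp hVinf) (hev hs)

end Limit

end FrameScaling

theorem theorem2p3 :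
    ∃ c C₁ C₂ : ℝ, 0 < c ∧ 0 < C₁ ∧ 0 < C₂ ∧
      ∀ (d n : ℕ) (V : Matrix (Fin d) (Fin n) ℝ) (ε lam : ℝ),
        FrameScaling.IsFrame V → 0 ≤ ε → 0 < lam →
        FrameScaling.DoublyBalanced V ε →
        FrameScaling.InftyExpansion V (1 - lam) →
        c * ε ≤ lam ^ 2 →
        (∃ Vt Lt Rt, FrameScaling.IsFlow V Vt Lt Rt) ∧
        ∀ Vt Lt Rt, FrameScaling.IsFlow V Vt Lt Rt →
          (∀ t, 0 ≤ t → (Rt t).IsDiag ∧ Vt t = Lt t * V * Rt t) ∧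
          ∃ (Linf : Matrix (Fin d) (Fin d) ℝ) (Rinf : Matrix (Fin n) (Fin n) ℝ),
            Tendsto Lt atTop (𝓝 Linf) ∧
            Tendsto Rt atTop (𝓝 Rinf) ∧
            Tendsto Vt atTop (𝓝 (Linf * V * Rinf)) ∧
            FrameScaling.IsScalingSolution V Linf Rinf ∧
            ‖Linf - 1‖ ≤ C₁ * (ε / lam) ∧
            ‖Rinf - 1‖ ≤ C₁ * (ε / lam) ∧
            FrameScaling.InftyExpansion (Linf * V * Rinf) (1 - lam / 2) ∧
            FrameScaling.size V * (1 - C₂ * (ε ^ 2 / lam)) ≤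
              FrameScaling.size (Linf * V * Rinf) := by
  open FrameScaling in
  refine ⟨2001, 48, 96, by norm_num, by norm_num, by norm_num, ?_⟩
  intro d n V ε lam hframe hε hlam hB hV hc
  refine ⟨hframe.exists_isFlow, fun Vt Lt Rt h ↦
    ⟨fun t ht ↦ ⟨h.isDiag ht, h.eq_mul ht⟩, ?_⟩⟩
  rcases Nat.eq_zero_or_pos d with rfl | hd
  -- For `d = 0` the size and both errors vanish, so `R_t` is constant; `lam ≤ 1` may fail here,
  -- hence the separate treatment.
  · have hsize : ∀ U : Matrix (Fin 0) (Fin n) ℝ, size U = 0 := fun U ↦ by simp [size]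
    have hE : ∀ U : Matrix (Fin 0) (Fin n) ℝ, errE U = 0 := fun U ↦ Subsingleton.elim _ _
    have hF : ∀ U : Matrix (Fin 0) (Fin n) ℝ, errF U = 0 := fun U ↦ by
      rw [errF_eq, ← Matrix.diagonal_zero]
      congr 1
      ext j
      simp [colErr, hsize]
    have hC : 0 ≤ 48 * (ε / lam) := by positivity
    refine h.exists_limit (K := 0) (μ := 1) le_rfl one_pos (fun t _ ↦ ?_) (fun t ht ↦ ?_)
      (fun t _ ↦ by simp [hE]) (fun t _ ↦ by simp [hF]) (fun t _ ↦ by simp [hsize])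
      (fun t _ y _ _ ↦ ?_)
    · rw [Subsingleton.elim (Lt t - 1) 0, norm_zero]
      exact hC
    · have := norm_sub_le_of_norm_deriv_le_exp_zero (K := 0) (μ := 1) one_pos le_rfl h.deriv_R
        (fun t _ ↦ by simp [hF]) ht
      rw [h.init_R, zero_div] at this
      exact this.trans hC
    · rw [Subsingleton.elim (∑ j, y j • Matrix.vecMulVec ((Vt t).col j) ((Vt t).col j)) 0]
      simp
  · have hs0 := hframe.size_pos hd
    -- Expansion at `y = 0` says that `size V * (1 - lam) / d` is nonnegative.
    have hlam1 : lam ≤ 1 := by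
      have hd' : (0 : ℝ) < d := by exact_mod_cast hd
      have h1 := hV 0 (by simp) (by simp)
      simp only [Pi.zero_apply, zero_smul, Finset.sum_const_zero, norm_zero] at h1
      by_contra! hcon
      have : size V * (1 - lam) / d < 0 :=
        div_neg_of_neg_of_pos (mul_neg_of_pos_of_neg hs0 (by linarith)) hd'
      linarith
    have hb := h.bounds hd hs0 hε hlam hlam1 hB hV hc
    exact h.exists_limit (K := 2 * ε * size V) (μ := size V * lam / 12) (by positivity)
      (by positivity) (fun t ht ↦ (hb t ht).1) (fun t ht ↦ (hb t ht).2.1)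
      (fun t ht ↦ (hb t ht).2.2.1) (fun t ht ↦ (hb t ht).2.2.2.1)
      (fun t ht ↦ (hb t ht).2.2.2.2.1) (fun t ht ↦ (hb t ht).2.2.2.2.2)
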